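/- **Setting.** Let $\mathcal X\subset\mathbb R^{d_x}$ and $\mathcal A\subset\mathbb R^{d_a}$ be finite sets of states and actions, where one coordinate of every state equals $1$ (bias coordinate); a pair $\xi=(x,a)$ is regarded as a vector of $\mathbb R^{d}$, $d=d_x+d_a$. Consider a Markov decision process on them with transition probabilities $p(x'\mid x,a)$, an initial law $\rho_0$ on $\mathcal X\times\mathcal A$ with state marginal $\rho_0(x)=\sum_a\rho_0(x,a)$, rewards $r(x,a)\in[-1,1]$ and discount factor $\gamma\in(0,1)$. A policy is a function $f\ge 0$ with $\sum_a f(x,a)=1$ for every $x$; it induces the chain on $\mathcal X\times\mathcal A$ with transition matrix $p(x'\mid x,a)f(x',a')$ and the auxiliary chain with transition matrix $[\gamma p(x'\mid x,a)+(1-\gamma)\rho_0(x')]f(x',a')$. Assume that both chains are irreducible and aperiodic whenever $f>0$; let $\pi^f$ be the stationary distribution of the first one. Write $V^f(\xi)=\sum_{k\ge0}\gamma^k\,\mathbb E[r(\xi_k)\mid \xi_0=\xi]$ for the action-value function, $V^f(x)=\sum_a f(x,a)V^f(x,a)$, $J(f)=\sum_x\rho_0(x)V^f(x)$, and $\sigma^f_{\rho_0}(x,a)=\sum_{k\ge0}\gamma^k\,\mathbb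 P(x_k=x,a_k=a)$ for the visiting measure of the chain with $x_0\sim\rho_0$ and $a_k\sim f(x_k,\cdot)$ (for what follows it may also be normalised to the probability measure $(1-\gamma)\sigma^f_{\rho_0}$). Let $\sigma:\mathbb R\to\mathbb R$ be a non-constant $C^2$ activation function with $|\sigma|,|\sigma'|,|\sigma''|\le1$ and $\sigma(x)/|x|^{a}\to0$ as $x\to\pm\infty$ for every $a>0$. Let $\nu_0(dc,dw)$ be a probability measure on $\mathbb R\times\mathbb R^d$, absolutely continuous with respect to Lebesgue measure, with $|c|\le 1$ almost surely; assume that $\sigma$ is real analytic or that the law of $w$ charges every non-empty open set. Put $$A_{\xi,\xi'}=\int\big[\sigma(w\cdot\xi')\sigma(w\cdot\xi)+c^2\sigma'(w\cdot\xi')\sigma'(w\cdot\xi)\,(\xi\cdot\xi')\big]\,\nu_0(dc,dw).$$ Let $\zeta_t=\frac1{1+t}$, $\eta_t=\frac{1}{1+\log^2(t+1)}$, $\alpha>0$, and $\mathsf{clip}(y)=\max(\min(y,h),\ell)$ with real numbers $\ell,h$ (for instance $\ell=0$, $h=2$). **Theorem.** Let $(P_t,Q_t)_{t\ge0}$, with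 values in $\mathbb R^{\mathcal X\times\mathcal A}\times\mathbb R^{\mathcal X\times\mathcal A}$ and with arbitrary initial value, solve for all $t\ge 0$ $$\frac{dQ_t}{dt}(\xi)=\alpha\sum_{\xi'}A_{\xi,\xi'}\Big(r(\xi')+\gamma\sum_{z,a''}Q_t(z,a'')g_t(z,a'')p(z\mid\xi')-Q_t(\xi')\Big)\pi^{g_t}(\xi'),$$ $$\frac{dP_t}{dt}(\xi)=\sum_{\xi'=(x',a')}\zeta_t\,\mathsf{clip}(Q_t(\xi'))\Big[A_{\xi,\xi'}-\sum_{a''}f_t(x',a'')A_{\xi,(x',a'')}\Big]\sigma^{g_t}_{\rho_0}(\xi'),$$ where $f_t(x,a)=\mathrm{Softmax}(P_t)(x,a)=e^{P_t(x,a)}/\sum_{a'}e^{P_t(x,a')}$ and $g_t=\frac{\eta_t}{\#\mathcal A}+(1-\eta_t)f_t$. Then, as $t\to\infty$, $$\max_{\xi}\big|Q_t(\xi)-V^{f_t}(\xi)\big|=O(\eta_t).$$ Moreover $P\mapsto J(\mathrm{Softmax}(P))$ is differentiable, and if the clipping window contains the values of the problem, i.e. $\ell\le V^f(\xi)\le h$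 for all policies $f$ and all $\xi$, then $$\nabla_P J(f_t)\to 0\qquad\text{as }t\to\infty,$$ where $\nabla_PJ(f_t)$ is the gradient of $P\mapsto J(\mathrm{Softmax}(P))$ at $P_t$. -/

import Mathlib

open scoped Topology

noncomputable section

namespace ActorCritic

/-- A finite Markov decision process: `p x a x'` is the probability of moving to `x'` from state `x`
under action `a`, `ρ₀` is the law of the initial state-action pair, `r` is the reward and `γ` the
discount factor. -/
structure MDP (X A : Type*) [Fintype X] [Fintype A] where
  p : X → A → X → ℝ
  p_nonneg : ∀ x a x', 0 ≤ p x a x'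
  p_sum : ∀ x a, ∑ x', p x a x' = 1
  ρ₀ : X × A → ℝ
  ρ₀_nonneg : ∀ ξ, 0 ≤ ρ₀ ξ
  ρ₀_sum : ∑ ξ, ρ₀ ξ = 1
  r : X × A → ℝ
  r_bound : ∀ ξ, |r ξ| ≤ 1
  γ : ℝ
  γ_pos : 0 < γ
  γ_lt_one : γ < 1

section Chains

/-- `f (x, a)` is the probability of selecting action `a` in state `x`. -/
structure IsPolicy {X A : Type*} [Fintype A] (f : X × A → ℝ) : Prop where
  nonneg : ∀ ξ, 0 ≤ f ξ
  sum_eq_one : ∀ x, ∑ a, f (x, a) = 1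

/-- Every state can be reached from every state. -/
def IsIrreducibleChain {S : Type*} [Fintype S] [DecidableEq S] (T : Matrix S S ℝ) : Prop :=
  ∀ i j, ∃ n : ℕ, 0 < (T ^ n) i j

/-- For every state, the greatest common divisor of its possible return times is `1`. -/
def IsAperiodicChain {S : Type*} [Fintype S] [DecidableEq S] (T : Matrix S S ℝ) : Prop :=
  ∀ i, ∀ d : ℕ, (∀ n : ℕ, 1 ≤ n → 0 < (T ^ n) i i → d ∣ n) → d = 1

/-- `π` is a stationary probability vector of the transition matrix `T`. -/
structure IsStationary {S : Type*} [Fintype S] (T : Matrix S S ℝ) (π : S → ℝ) : Prop where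
  nonneg : ∀ i, 0 ≤ π i
  sum_eq_one : ∑ i, π i = 1
  stationary : Matrix.vecMul π T = π

variable {X A : Type*} [Fintype X] [Fintype A]

/-- The law of the initial state. -/
def MDP.initState (M : MDP X A) (x : X) : ℝ := ∑ a, M.ρ₀ (x, a)

/-- Transition matrix of the state-action chain induced by the policy `f`. -/
def MDP.trans (M : MDP X A) (f : X × A → ℝ) : Matrix (X × A) (X × A) ℝ :=
  Matrix.of fun ξ ξ' => M.p ξ.1 ξ.2 ξ'.1 * f ξ'

/-- Transition matrix of the auxiliary chain, which restarts from the initial state law with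
probability `1 - γ` at every step. -/
def MDP.transAux (M : MDP X A) (f : X × A → ℝ) : Matrix (X × A) (X × A) ℝ :=
  Matrix.of fun ξ ξ' => (M.γ * M.p ξ.1 ξ.2 ξ'.1 + (1 - M.γ) * M.initState ξ'.1) * f ξ'

variable [DecidableEq X] [DecidableEq A]

/-- Both the chain and the auxiliary chain are ergodic under every policy that selects every action
with positive probability. -/
def MDP.IsErgodic (M : MDP X A) : Prop :=
  ∀ f : X × A → ℝ, IsPolicy f → (∀ ξ, 0 < f ξ) →
    (IsIrreducibleChain (M.trans f) ∧ IsAperiodicChain (M.trans f)) ∧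
    (IsIrreducibleChain (M.transAux f) ∧ IsAperiodicChain (M.transAux f))

/-- Action-value function `V^f(x, a) = ∑ₖ γᵏ 𝔼[r(ξₖ) | ξ₀ = (x, a)]`. -/
def MDP.actionValue (M : MDP X A) (f : X × A → ℝ) (ξ : X × A) : ℝ :=
  ∑' k : ℕ, M.γ ^ k * ((M.trans f) ^ k).mulVec M.r ξ

/-- State-value function: the first action is drawn from the policy. -/
def MDP.stateValue (M : MDP X A) (f : X × A → ℝ) (x : X) : ℝ :=
  ∑ a, f (x, a) * M.actionValue f (x, a)

/-- The objective `J(f) = ∑ₓ ρ₀(x) V^f(x)`. -/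
def MDP.objective (M : MDP X A) (f : X × A → ℝ) : ℝ :=
  ∑ x, M.initState x * M.stateValue f x

/-- The law of `ξₖ = (xₖ, aₖ)` when `x₀` has the initial state law and all actions are drawn
from `f`. -/
def MDP.law (M : MDP X A) (f : X × A → ℝ) (k : ℕ) : X × A → ℝ :=
  Matrix.vecMul (fun ξ => M.initState ξ.1 * f ξ) ((M.trans f) ^ k)

/-- State-action visiting measure `σ(x, a) = ∑ₖ γᵏ ℙ(xₖ = x, aₖ = a)`. -/
def MDP.visiting (M : MDP X A) (f : X × A → ℝ) (ξ : X × A) : ℝ :=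
  ∑' k : ℕ, M.γ ^ k * M.law f k ξ

end Chains

/-- Softmax policy with logits `P`. -/
def softmax {X A : Type*} [Fintype A] (P : X × A → ℝ) (ξ : X × A) : ℝ :=
  Real.exp (P ξ) / ∑ a, Real.exp (P (ξ.1, a))

/-- The vector of partial derivatives `∂ J(softmax P) / ∂ P(ξ)`. -/
def MDP.policyGradient {X A : Type*} [Fintype X] [Fintype A] [DecidableEq X] [DecidableEq A]
    (M : MDP X A) (P : X × A → ℝ) (ξ : X × A) : ℝ :=
  fderiv ℝ (fun P' : X × A → ℝ => M.objective (softmax P')) P (Pi.single ξ 1)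

/-- Actor learning rate. -/
def zeta (t : ℝ) : ℝ := 1 / (1 + t)

/-- Exploration rate. -/
def eta (t : ℝ) : ℝ := 1 / (1 + Real.log (t + 1) ^ 2)

/-- Exploration policy `g_t = η_t / #A + (1 - η_t) softmax P`. -/
def explore {X A : Type*} [Fintype A] (t : ℝ) (P : X × A → ℝ) (ξ : X × A) : ℝ :=
  eta t / (Fintype.card A : ℝ) + (1 - eta t) * softmax P ξ

/-- Truncation of a real number to the window `[lo, hi]`. -/
def clip (lo hi x : ℝ) : ℝ := max (min x hi) lo

/-- Assumptions on the activation function. -/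
structure IsActivation (act : ℝ → ℝ) : Prop where
  contDiff : ContDiff ℝ 2 act
  bound : ∀ x, |act x| ≤ 1
  deriv_bound : ∀ x, |deriv act x| ≤ 1
  deriv_two_bound : ∀ x, |deriv (deriv act) x| ≤ 1
  slow_atTop : ∀ a : ℝ, 0 < a → Filter.Tendsto (fun x => act x / |x| ^ a) Filter.atTop (𝓝 0)
  slow_atBot : ∀ a : ℝ, 0 < a → Filter.Tendsto (fun x => act x / |x| ^ a) Filter.atBot (𝓝 0)

/-- The space `ℝ^{dx + da}` of state-action vectors and of network weights. -/
abbrev Feat (dx da : ℕ) : Type := EuclideanSpace ℝ (Fin dx ⊕ Fin da)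

/-- The vector `(x, a) ∈ ℝ^{dx + da}` of a state-action pair, where `eX` and `eA` are the positions
of states and actions in `ℝ^{dx}` and `ℝ^{da}`. -/
def feature {X A : Type*} {dx da : ℕ} (eX : X → EuclideanSpace ℝ (Fin dx))
    (eA : A → EuclideanSpace ℝ (Fin da)) (ξ : X × A) : Feat dx da :=
  WithLp.toLp 2 (Sum.elim (fun i => eX ξ.1 i) (fun j => eA ξ.2 j))

/-- The limiting neural tangent kernel. -/
def kernel {X A : Type*} {dx da : ℕ} (eX : X → EuclideanSpace ℝ (Fin dx))
    (eA : A → EuclideanSpace ℝ (Fin da)) (act : ℝ → ℝ)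
    (ν₀ : MeasureTheory.Measure (ℝ × Feat dx da)) (ξ ξ' : X × A) : ℝ :=
  ∫ z : ℝ × Feat dx da,
    (act (inner ℝ z.2 (feature eX eA ξ')) * act (inner ℝ z.2 (feature eX eA ξ))
      + z.1 ^ 2 * deriv act (inner ℝ z.2 (feature eX eA ξ'))
        * deriv act (inner ℝ z.2 (feature eX eA ξ))
        * inner ℝ (feature eX eA ξ) (feature eX eA ξ')) ∂ν₀

/-- `(P, Q)` solves the limit ODE on `[0, ∞)` with kernel `K`, critic rate `α`, clipping window
`[lo, hi]`, and the visiting measure multiplied by the normalisation constant `κ`. -/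
structure IsLimitODESolution {X A : Type*} [Fintype X] [Fintype A] [DecidableEq X] [DecidableEq A]
    (M : MDP X A) (K : X × A → X × A → ℝ) (α κ lo hi : ℝ) (P Q : ℝ → X × A → ℝ) : Prop where
  critic : ∀ t : ℝ, 0 ≤ t → ∃ π : X × A → ℝ, IsStationary (M.trans (explore t (P t))) π ∧
    HasDerivWithinAt Q
      (fun ξ => α * ∑ ξ' : X × A, K ξ ξ' *
        (M.r ξ' + M.γ * (∑ z : X, ∑ a : A, Q t (z, a) * explore t (P t) (z, a) * M.p ξ'.1 ξ'.2 z)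
          - Q t ξ') * π ξ')
      (Set.Ici 0) t
  actor : ∀ t : ℝ, 0 ≤ t →
    HasDerivWithinAt P
      (fun ξ => ∑ ξ' : X × A, zeta t * clip lo hi (Q t ξ') *
        (K ξ ξ' - ∑ a : A, softmax (P t) (ξ'.1, a) * K ξ (ξ'.1, a)) *
        (κ * M.visiting (explore t (P t)) ξ'))
      (Set.Ici 0) t

end ActorCritic

end

/-! The actor moves at speed `O(1/(1+t))`, while the critic is damped at a rate that is only
polylogarithmically small. The critic therefore sees a nearly frozen policy, and the actor performs
preconditioned gradient ascent with integrable errors.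

Kernel. Its quadratic form dominates the integral of the square of a combination of ridge functions
of the activation. The bias coordinate prevents distinct features from being parallel, so these
ridge functions are linearly independent and the kernel is positive definite (`kernel_posDef`). Its
inverse `B` then defines a Lyapunov function.

Critic. Put `φ = Q - V^g`. In the derivative of `φᵀBφ` the kernel cancels and leaves the Bellman
operator weighted by the stationary law `π`, which contributes at most `-(1-γ) Σ π φ²` up to
positive factors (`stationary_dissipative`). Exploration forces `π ≥ c η^n`
(`stationary_lower_bound`), and `V^g` drifts at speed `O(1/(1+t))`. Since `η` decays only like a
power of the logarithm, comparison with a multiple of `η²` gives `‖φ‖ = O(η)`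
(`le_eta_sq_of_damped`). Replacing `V^g` by `V^f` costs another `O(η)`.

Actor. The gradient of `J` in the logits is the centred product of visiting measure and value
(`MDP.objective_hasFDerivAt`). The actor follows `κ ζ` times the kernel applied to the same
expression, up to an error `O(η)` (`IsLimitODESolution.actor_direction`). In the time `u = log(1+t)`
the factor `ζ` disappears and `η` becomes `1/(1+u²)`, which is integrable. Hence `dJ/du ≥ κ (a ‖∇J‖²
- C/(1+u²))` with `J` bounded and `‖∇J‖²` Lipschitz in `u`, and a Barbalat argument
(`tendsto_zero_of_lipschitz_of_le_deriv`) gives `∇J → 0`. -/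

noncomputable section

namespace ActorCritic

/-! ### Ridge functions and zero sets of analytic functions -/

section KernelPositivity

open MeasureTheory

/-- A bounded function all of whose finite differences are constant is constant. -/
theorem const_of_bounded_of_differences_const {g : ℝ → ℝ} {C : ℝ} (hg : ∀ x, |g x| ≤ C)
    (hd : ∀ h x y, g (x + h) - g x = g (y + h) - g y) (x y : ℝ) : g x = g y := by
  set h := y - x with hh
  set d := g y - g x with hdd
  -- Equal increments make `g` affine along the progression `x + k h`, which boundedness allows only
  -- for slope zero.
  have hk : ∀ k : ℕ, g (x + k * h) = g x + k * d := by
    intro k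
    induction k with
    | zero => simp
    | succ k ih =>
      have := hd h (x + k * h) x
      have e : x + h = y := by rw [hh]; ring
      rw [e] at this
      push_cast
      rw [show x + ((k : ℝ) + 1) * h = x + k * h + h by ring]
      rw [hdd] at ih ⊢
      linarith
  have hd0 : d = 0 := by
    by_contra hne
    obtain ⟨k, hk'⟩ := exists_nat_gt (2 * C / |d|)
    have h1 := hg (x + k * h)
    have h2 := hg x
    rw [hk k] at h1
    have h3 : (k : ℝ) * |d| ≤ 2 * C := by
      rw [← Nat.abs_cast k, ← abs_mul]
      have := abs_sub (g x + k * d) (g x)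
      rw [add_sub_cancel_left] at this
      linarith
    rw [div_lt_iff₀ (abs_pos.2 hne)] at hk'
    linarith
  linarith [hd0.symm.trans hdd]

/-- If a sum of bounded ridge functions with pairwise non-parallel directions vanishes, each of them
is constant. -/
theorem ridge_const {ι E : Type*} [DecidableEq ι] [NormedAddCommGroup E] [InnerProductSpace ℝ E]
    (v : ι → E) (hv : ∀ i, v i ≠ 0)
    (hsep : ∀ i j, i ≠ j → ∃ w, inner ℝ w (v j) = 0 ∧ inner ℝ w (v i) ≠ 0) (S : Finset ι) :
    ∀ g : ι → ℝ → ℝ, (∀ i, ∃ C, ∀ x, |g i x| ≤ C) →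
      (∀ w, ∑ i ∈ S, g i (inner ℝ w (v i)) = 0) → ∀ i ∈ S, ∀ x y, g i x = g i y := by
  induction S using Finset.induction_on with
  | empty => simp
  | insert j S hj ih =>
    intro g hb h0
    have key : ∀ i ∈ S, ∀ x y, g i x = g i y := by
      intro i hi
      obtain ⟨C, hC⟩ := hb i
      refine const_of_bounded_of_differences_const hC fun h x y => ?_
      have hij : i ≠ j := fun e => hj (e ▸ hi)
      obtain ⟨w, hwj, hwi⟩ := hsep i j hij
      -- Translation by `w'` fixes the argument of the `j`-th ridge function and shifts that of the
      -- `i`-th by exactly `h`. Differencing along `w'` thus removes `j`, and the induction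
      -- hypothesis applies to the differences.
      set w' := (h / inner ℝ w (v i)) • w with hw'
      have hw'j : inner ℝ w' (v j) = 0 := by rw [hw', real_inner_smul_left, hwj, mul_zero]
      have hw'i : inner ℝ w' (v i) = h := by
        rw [hw', real_inner_smul_left, div_mul_cancel₀ _ hwi]
      have := ih (fun k x => g k (x + inner ℝ w' (v k)) - g k x) ?_ ?_ i hi x y
      · simpa [hw'i] using this
      · intro k
        obtain ⟨D, hD⟩ := hb k
        exact ⟨D + D, fun x => (abs_sub _ _).trans (add_le_add (hD _) (hD _))⟩
      · intro z
        have h1 := h0 (z + w')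
        have h2 := h0 z
        rw [Finset.sum_insert hj] at h1 h2
        simp only [inner_add_left, hw'j, add_zero] at h1
        rw [Finset.sum_sub_distrib]
        linarith
    intro i hi
    rcases Finset.mem_insert.1 hi with rfl | hi
    · intro x y
      have surj : ∀ x : ℝ, ∃ w, inner ℝ w (v i) = x := fun x =>
        ⟨(x / inner ℝ (v i) (v i)) • v i, by
          rw [real_inner_smul_left, div_mul_cancel₀ _ (inner_self_ne_zero.2 (hv i))]⟩
      obtain ⟨w, rfl⟩ := surj x
      obtain ⟨w', rfl⟩ := surj y
      have h1 := h0 w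
      have h2 := h0 w'
      rw [Finset.sum_insert hj] at h1 h2
      have h3 : ∑ k ∈ S, g k (inner ℝ w (v k)) = ∑ k ∈ S, g k (inner ℝ w' (v k)) :=
        Finset.sum_congr rfl fun k hk => key k hk _ _
      linarith
    · exact key i hi

/-- The zero set of a nonzero real analytic function is a null set. -/
theorem measure_zeros_of_analytic {E : Type*} [NormedAddCommGroup E] [NormedSpace ℝ E]
    [FiniteDimensional ℝ E] [MeasurableSpace E] [BorelSpace E] (μ : Measure E)
    [μ.IsAddHaarMeasure] {F : E → ℝ} (hF : AnalyticOnNhd ℝ F Set.univ) {w₀ : E} (h0 : F w₀ ≠ 0) :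
    μ {w | F w = 0} = 0 := by
  have hc : Continuous F := continuousOn_univ.1 hF.continuousOn
  -- Fubini on pairs (direction, time): on each line through `w₀` the restriction of `F` is analytic
  -- and nonzero at time `0`, so it has a null zero set.
  set s : Set (E × ℝ) := {q | F (w₀ + q.2 • q.1) = 0} with hs
  have hsm : MeasurableSet s := by
    have : IsClosed s := isClosed_eq (hc.comp (by fun_prop)) continuous_const
    exact this.measurableSet
  have hnull : (μ.prod volume) s = 0 := by
    refine Measure.measure_prod_null_of_ae_null hsm (Filter.Eventually.of_forall fun w => ?_)
    have ha : AnalyticOnNhd ℝ (fun t : ℝ => F (w₀ + t • w)) Set.univ := by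
      intro t _
      refine (hF _ (Set.mem_univ _)).fun_comp (f := fun t : ℝ => w₀ + t • w) ?_
      fun_prop
    have hm := ha.preimage_zero_mem_codiscrete (x := 0) (by simpa using h0)
    have hae := ae_restrict_le_codiscreteWithin (μ := (volume : Measure ℝ)) (U := Set.univ)
      MeasurableSet.univ hm
    rw [Measure.restrict_univ, mem_ae_iff] at hae
    refine measure_mono_null ?_ hae
    intro t ht
    simpa [hs] using ht
  rw [← Measure.prod_swap, Measure.map_apply measurable_swap hsm] at hnull
  have hae := Measure.measure_ae_null_of_prod_null hnull
  have hne : ∀ᵐ t : ℝ, t ≠ 0 := by simp [ae_iff]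
  -- A single nonzero time suffices: its section is an affine image of the zero set of `F`, and Haar
  -- measure scales by a nonzero factor.
  obtain ⟨t, ht, ht0⟩ := (hae.and hne).exists
  have e : Prod.mk t ⁻¹' (Prod.swap ⁻¹' s) = (t • ·) ⁻¹' ((w₀ + ·) ⁻¹' {w | F w = 0}) := by
    ext w; simp [hs]
  simp only [e, Pi.zero_apply] at ht
  rw [Measure.addHaar_preimage_smul μ ht0, measure_preimage_add, mul_eq_zero] at ht
  refine ht.resolve_left ?_
  simp [ht0]

end KernelPositivity

/-! ### Positive definiteness of the neural tangent kernel -/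

section KernelPosDef

open MeasureTheory

variable {X A : Type*} {dx da : ℕ} {eX : X → EuclideanSpace ℝ (Fin dx)}
  {eA : A → EuclideanSpace ℝ (Fin da)}

theorem feature_injective (heX : Function.Injective eX) (heA : Function.Injective eA) :
    Function.Injective (feature eX eA) := by
  rintro ⟨x, a⟩ ⟨y, b⟩ h
  have h' : ∀ k, feature eX eA (x, a) k = feature eX eA (y, b) k := fun k => by rw [h]
  refine Prod.ext (heX ?_) (heA ?_)
  · ext i; simpa [feature] using h' (Sum.inl i)
  · ext i; simpa [feature] using h' (Sum.inr i)

/-- Two distinct feature vectors with a common bias coordinate are separated by a direction that is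
orthogonal to one of them. -/
theorem exists_orthogonal_separating {ι : Type*} [Fintype ι] {v w : EuclideanSpace ℝ ι} {i : ι}
    (hv : v i = 1) (hw : w i = 1) (hne : v ≠ w) :
    ∃ z : EuclideanSpace ℝ ι, inner ℝ z w = 0 ∧ inner ℝ z v ≠ 0 := by
  by_contra! hcon
  have hw0 : w ≠ 0 := by rintro rfl; simp at hw
  -- Test with the component of `v` orthogonal to `w`. If it is orthogonal to `v` as well, it
  -- vanishes, so `v` is a multiple of `w`, and the common bias coordinate makes the factor `1`.
  have hs := hcon (v - (inner ℝ v w / inner ℝ w w) • w) (by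
    rw [inner_sub_left, real_inner_smul_left, div_mul_cancel₀ _ (inner_self_ne_zero.2 hw0),
      sub_self])
  set c := (inner ℝ v w / inner ℝ w w : ℝ) with hc
  have h2 : inner ℝ (v - c • w) w = (0 : ℝ) := by
    rw [inner_sub_left, real_inner_smul_left, hc, div_mul_cancel₀ _ (inner_self_ne_zero.2 hw0),
      sub_self]
  have h3 : inner ℝ (v - c • w) (v - c • w) = (0 : ℝ) := by
    rw [inner_sub_right, real_inner_smul_right, hs, h2]; simp
  have h4 : v = c • w := sub_eq_zero.1 (inner_self_eq_zero.1 h3)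
  have h5 : (1 : ℝ) = c := by
    have := congrArg (fun u : EuclideanSpace ℝ ι => u i) h4
    simpa [hv, hw] using this
  exact hne (by rw [h4, ← h5, one_smul])

/-- Ridge functions of the activation along distinct features are linearly independent. -/
theorem activation_independent [Fintype X] [Fintype A] [DecidableEq X] [DecidableEq A]
    (heX : Function.Injective eX) (heA : Function.Injective eA)
    (hbias : ∃ i : Fin dx, ∀ x, eX x i = 1) {act : ℝ → ℝ} (hb : ∀ x, |act x| ≤ 1)
    (hconst : ∃ x y, act x ≠ act y) (u : X × A → ℝ)
    (h0 : ∀ w, ∑ ξ, u ξ * act (inner ℝ w (feature eX eA ξ)) = 0) : u = 0 := by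
  obtain ⟨i, hi⟩ := hbias
  have hone : ∀ ξ, feature eX eA ξ (Sum.inl i) = 1 := fun ξ => by simp [feature, hi]
  obtain ⟨x, y, hxy⟩ := hconst
  funext ξ
  have := ridge_const (feature eX eA) (fun ξ h => by simpa [h] using hone ξ)
    (fun ξ ξ' hne => exists_orthogonal_separating (hone ξ) (hone ξ')
      ((feature_injective heX heA).ne hne)) Finset.univ (fun ξ x => u ξ * act x)
    (fun ξ => ⟨|u ξ|, fun x => by
      rw [abs_mul]; exact mul_le_of_le_one_right (abs_nonneg _) (hb x)⟩) h0 ξ (Finset.mem_univ _) x y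
  by_contra hu
  exact hxy (mul_left_cancel₀ hu this)

variable {act : ℝ → ℝ} {ν₀ : Measure (ℝ × Feat dx da)}

theorem kernel_symm (ξ ξ' : X × A) : kernel eX eA act ν₀ ξ ξ' = kernel eX eA act ν₀ ξ' ξ := by
  unfold kernel
  congr 1
  funext z
  rw [real_inner_comm (feature eX eA ξ) (feature eX eA ξ')]
  ring

variable [IsProbabilityMeasure ν₀]

theorem kernel_integrable (hact : IsActivation act) (hc : ∀ᵐ z ∂ν₀, |z.1| ≤ 1) (ξ ξ' : X × A) :
    Integrable (fun z : ℝ × Feat dx da =>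
      act (inner ℝ z.2 (feature eX eA ξ')) * act (inner ℝ z.2 (feature eX eA ξ))
      + z.1 ^ 2 * deriv act (inner ℝ z.2 (feature eX eA ξ'))
        * deriv act (inner ℝ z.2 (feature eX eA ξ))
        * inner ℝ (feature eX eA ξ) (feature eX eA ξ')) ν₀ := by
  have c1 : Continuous act := hact.contDiff.continuous
  have c2 : Continuous (deriv act) := hact.contDiff.continuous_deriv (by norm_num)
  refine Integrable.of_bound (C := 1 + |inner ℝ (feature eX eA ξ) (feature eX eA ξ')|)
    (Continuous.aestronglyMeasurable (by fun_prop)) ?_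
  filter_upwards [hc] with z hz
  rw [Real.norm_eq_abs]
  refine (abs_add_le _ _).trans (add_le_add ?_ ?_)
  · rw [abs_mul]
    exact mul_le_one₀ (hact.bound _) (abs_nonneg _) (hact.bound _)
  · rw [abs_mul, abs_mul, abs_mul, abs_pow]
    refine mul_le_of_le_one_left (abs_nonneg _) ?_
    refine mul_le_one₀ (mul_le_one₀ (pow_le_one₀ (abs_nonneg _) hz) (abs_nonneg _)
      (hact.deriv_bound _)) (abs_nonneg _) (hact.deriv_bound _)

variable [Fintype X] [Fintype A]

/-- The integrand of the kernel is a Gram matrix for each fixed `(c, w)`, so its quadratic form is a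
sum of two squares. Only the first square is needed for definiteness. -/
theorem kernel_quadratic (hact : IsActivation act) (hc : ∀ᵐ z ∂ν₀, |z.1| ≤ 1) (u : X × A → ℝ) :
    ∑ ξ, u ξ * ∑ ξ', kernel eX eA act ν₀ ξ ξ' * u ξ' =
      ∫ z, ((∑ ξ, u ξ * act (inner ℝ z.2 (feature eX eA ξ))) ^ 2 + z.1 ^ 2 *
        ‖∑ ξ, (u ξ * deriv act (inner ℝ z.2 (feature eX eA ξ))) • feature eX eA ξ‖ ^ 2) ∂ν₀ ∧
    Integrable (fun z : ℝ × Feat dx da =>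
      ((∑ ξ, u ξ * act (inner ℝ z.2 (feature eX eA ξ))) ^ 2 + z.1 ^ 2 *
        ‖∑ ξ, (u ξ * deriv act (inner ℝ z.2 (feature eX eA ξ))) • feature eX eA ξ‖ ^ 2)) ν₀ := by
  have e : ∀ z : ℝ × Feat dx da,
      (∑ ξ, u ξ * act (inner ℝ z.2 (feature eX eA ξ))) ^ 2 + z.1 ^ 2 *
        ‖∑ ξ, (u ξ * deriv act (inner ℝ z.2 (feature eX eA ξ))) • feature eX eA ξ‖ ^ 2 =
      ∑ ξ, ∑ ξ', (act (inner ℝ z.2 (feature eX eA ξ')) * act (inner ℝ z.2 (feature eX eA ξ))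
      + z.1 ^ 2 * deriv act (inner ℝ z.2 (feature eX eA ξ'))
        * deriv act (inner ℝ z.2 (feature eX eA ξ))
        * inner ℝ (feature eX eA ξ) (feature eX eA ξ')) * (u ξ * u ξ') := by
    intro z
    rw [← real_inner_self_eq_norm_sq, sum_inner, sq (∑ ξ, _), Finset.sum_mul_sum, Finset.mul_sum,
      ← Finset.sum_add_distrib]
    refine Finset.sum_congr rfl fun ξ _ => ?_
    rw [inner_sum, Finset.mul_sum, ← Finset.sum_add_distrib]
    refine Finset.sum_congr rfl fun ξ' _ => ?_
    rw [real_inner_smul_left, real_inner_smul_right]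
    ring
  have hint := fun ξ ξ' : X × A => (kernel_integrable (eX := eX) (eA := eA) hact hc ξ ξ').mul_const
    (u ξ * u ξ')
  simp only [e]
  constructor
  · rw [integral_finsetSum _ fun ξ _ => integrable_finsetSum _ fun ξ' _ => hint ξ ξ']
    refine Finset.sum_congr rfl fun ξ _ => ?_
    rw [integral_finsetSum _ fun ξ' _ => hint ξ ξ', Finset.mul_sum]
    refine Finset.sum_congr rfl fun ξ' _ => ?_
    rw [integral_mul_const, kernel]
    ring
  · exact integrable_finsetSum _ fun ξ _ => integrable_finsetSum _ fun ξ' _ => hint ξ ξ'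

/-- The limiting neural tangent kernel is positive definite. -/
theorem kernel_posDef [DecidableEq X] [DecidableEq A]
    (heX : Function.Injective eX) (heA : Function.Injective eA)
    (hbias : ∃ i : Fin dx, ∀ x, eX x i = 1)
    (hact : IsActivation act) (hconst : ∃ x y, act x ≠ act y)
    (hac : Measure.AbsolutelyContinuous ν₀ volume) (hc : ∀ᵐ z ∂ν₀, |z.1| ≤ 1)
    (hw : AnalyticOnNhd ℝ act Set.univ ∨
      ∀ U : Set (Feat dx da), IsOpen U → U.Nonempty → 0 < ν₀ (Prod.snd ⁻¹' U)) :
    (Matrix.of (kernel eX eA act ν₀)).PosDef := by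
  refine Matrix.PosDef.of_dotProduct_mulVec_pos ?_ fun u hu => ?_
  · ext ξ ξ'
    simpa using kernel_symm ξ' ξ
  obtain ⟨hq, hi⟩ := kernel_quadratic (eX := eX) (eA := eA) hact hc u
  have : star u ⬝ᵥ (Matrix.of (kernel eX eA act ν₀)).mulVec u =
      ∑ ξ, u ξ * ∑ ξ', kernel eX eA act ν₀ ξ ξ' * u ξ' := by
    simp [dotProduct, Matrix.mulVec]
  rw [this, hq]
  have hnn : ∀ z : ℝ × Feat dx da, 0 ≤ (∑ ξ, u ξ * act (inner ℝ z.2 (feature eX eA ξ))) ^ 2 +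
      z.1 ^ 2 * ‖∑ ξ, (u ξ * deriv act (inner ℝ z.2 (feature eX eA ξ))) • feature eX eA ξ‖ ^ 2 :=
    fun z => by positivity
  refine lt_of_le_of_ne (integral_nonneg hnn) fun h0 => hu ?_
  have hae := (integral_eq_zero_iff_of_nonneg hnn hi).1 h0.symm
  set F : Feat dx da → ℝ := fun w => ∑ ξ, u ξ * act (inner ℝ w (feature eX eA ξ)) with hF
  have hFae : ∀ᵐ z ∂ν₀, F z.2 = 0 := by
    filter_upwards [hae] with z hz
    have h1 : 0 ≤ z.1 ^ 2 *
      ‖∑ ξ, (u ξ * deriv act (inner ℝ z.2 (feature eX eA ξ))) • feature eX eA ξ‖ ^ 2 := by positivity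
    simp only [Pi.zero_apply] at hz
    have h2 : F z.2 ^ 2 = 0 := le_antisymm (by linarith) (sq_nonneg _)
    exact pow_eq_zero_iff (two_ne_zero) |>.1 h2
  refine activation_independent heX heA hbias hact.bound hconst u fun w => ?_
  by_contra hne
  change F w ≠ 0 at hne
  -- Either the zero set of the nonzero analytic `F` is Lebesgue-null, against absolute continuity,
  -- or the nonempty open set `F ≠ 0` is charged. Both contradict `hFae`.
  rcases hw with han | hopen
  · have hFan : AnalyticOnNhd ℝ F Set.univ := by
      intro w _
      refine Finset.analyticAt_fun_sum _ fun ξ _ => analyticAt_const.mul ?_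
      refine (han _ (Set.mem_univ _)).fun_comp (f := fun w => inner ℝ w (feature eX eA ξ)) ?_
      have : (fun w : Feat dx da => inner ℝ w (feature eX eA ξ)) =
          fun w => innerSL ℝ (feature eX eA ξ) w := by
        funext w; simp [real_inner_comm]
      rw [this]
      exact ContinuousLinearMap.analyticAt _ _
    have hz := measure_zeros_of_analytic (volume : Measure (Feat dx da)) hFan hne
    have hz' : (volume : Measure (ℝ × Feat dx da)) (Prod.snd ⁻¹' {w | F w = 0}) = 0 := by
      have := Measure.quasiMeasurePreserving_snd (μ := (volume : Measure ℝ))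
        (ν := (volume : Measure (Feat dx da)))
      exact this.preimage_null hz
    have h1 := hac hz'
    have h2 : ∀ᵐ z ∂ν₀, F z.2 ≠ 0 := by
      rw [ae_iff]; simpa using h1
    obtain ⟨z, hz1, hz2⟩ := (hFae.and h2).exists
    exact hz2 hz1
  · have c1 : Continuous act := hact.contDiff.continuous
    have hop : IsOpen {w | F w ≠ 0} := isOpen_ne_fun (by fun_prop) continuous_const
    have := hopen _ hop ⟨w, hne⟩
    rw [ae_iff] at hFae
    exact this.ne' hFae

end KernelPosDef

/-! ### Discounted equations and stationary laws of stochastic matrices -/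

section StochasticMatrices

open Matrix

variable {S : Type*} [Fintype S] [DecidableEq S] {T : Matrix S S ℝ}

theorem norm_mulVec_le_of_stochastic (hT : T ∈ rowStochastic ℝ S) (v : S → ℝ) :
    ‖T *ᵥ v‖ ≤ ‖v‖ := by
  refine (pi_norm_le_iff_of_nonneg (norm_nonneg _)).2 fun i => ?_
  rw [Real.norm_eq_abs, mulVec, dotProduct]
  calc |∑ j, T i j * v j| ≤ ∑ j, |T i j * v j| := Finset.abs_sum_le_sum_abs _ _
    _ ≤ ∑ j, T i j * ‖v‖ := Finset.sum_le_sum fun j _ => by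
        rw [abs_mul, abs_of_nonneg (nonneg_of_mem_rowStochastic hT)]
        exact mul_le_mul_of_nonneg_left (norm_le_pi_norm v j) (nonneg_of_mem_rowStochastic hT)
    _ = ‖v‖ := by rw [← Finset.sum_mul, sum_row_of_mem_rowStochastic hT, one_mul]

theorem sum_abs_vecMul_le_of_stochastic (hT : T ∈ rowStochastic ℝ S) (u : S → ℝ) :
    ∑ j, |(u ᵥ* T) j| ≤ ∑ i, |u i| := by
  calc ∑ j, |(u ᵥ* T) j| ≤ ∑ j, ∑ i, |u i| * T i j := Finset.sum_le_sum fun j _ => by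
        rw [vecMul, dotProduct]
        refine (Finset.abs_sum_le_sum_abs _ _).trans (Finset.sum_le_sum fun i _ => ?_)
        rw [abs_mul, abs_of_nonneg (nonneg_of_mem_rowStochastic hT)]
    _ = ∑ i, |u i| := by
        rw [Finset.sum_comm]
        refine Finset.sum_congr rfl fun i _ => ?_
        rw [← Finset.mul_sum, sum_row_of_mem_rowStochastic hT, mul_one]

theorem summable_discounted_mulVec (hT : T ∈ rowStochastic ℝ S) {γ : ℝ} (h0 : 0 ≤ γ) (h1 : γ < 1)
    (r : S → ℝ) (i : S) : Summable fun k : ℕ => γ ^ k * ((T ^ k) *ᵥ r) i := by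
  refine Summable.of_norm_bounded (g := fun k => γ ^ k * ‖r‖)
    ((summable_geometric_of_lt_one h0 h1).mul_right _) fun k => ?_
  rw [norm_mul, norm_pow, Real.norm_of_nonneg h0]
  exact mul_le_mul_of_nonneg_left ((norm_le_pi_norm _ i).trans
    (norm_mulVec_le_of_stochastic (pow_mem hT k) r)) (pow_nonneg h0 k)

theorem discounted_mulVec_eq (hT : T ∈ rowStochastic ℝ S) {γ : ℝ} (h0 : 0 ≤ γ) (h1 : γ < 1)
    (r : S → ℝ) (i : S) :
    ∑' k : ℕ, γ ^ k * ((T ^ k) *ᵥ r) i =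
      r i + γ * ∑ j, T i j * ∑' k : ℕ, γ ^ k * ((T ^ k) *ᵥ r) j := by
  have hs := summable_discounted_mulVec hT h0 h1 r
  rw [(hs i).tsum_eq_zero_add]
  congr 1
  · simp
  · simp_rw [← tsum_mul_left]
    rw [← Summable.tsum_finsetSum fun j _ => (hs j).mul_left _, ← tsum_mul_left]
    refine tsum_congr fun k => ?_
    rw [_root_.pow_succ' T, ← mulVec_mulVec, mulVec, dotProduct, pow_succ, mul_comm (γ ^ k),
      mul_assoc, Finset.mul_sum]
    congr 1
    exact Finset.sum_congr rfl fun j _ => by ring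

theorem summable_discounted_vecMul (hT : T ∈ rowStochastic ℝ S) {γ : ℝ} (h0 : 0 ≤ γ) (h1 : γ < 1)
    (m : S → ℝ) (i : S) : Summable fun k : ℕ => γ ^ k * (m ᵥ* (T ^ k)) i := by
  refine Summable.of_norm_bounded (g := fun k => γ ^ k * ∑ i, |m i|)
    ((summable_geometric_of_lt_one h0 h1).mul_right _) fun k => ?_
  rw [norm_mul, norm_pow, Real.norm_of_nonneg h0]
  refine mul_le_mul_of_nonneg_left ?_ (pow_nonneg h0 k)
  refine le_trans ?_ (sum_abs_vecMul_le_of_stochastic (pow_mem hT k) m)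
  exact Finset.single_le_sum (f := fun j => |(m ᵥ* (T ^ k)) j|) (fun j _ => abs_nonneg _)
    (Finset.mem_univ i)

theorem discounted_vecMul_eq (hT : T ∈ rowStochastic ℝ S) {γ : ℝ} (h0 : 0 ≤ γ) (h1 : γ < 1)
    (m : S → ℝ) (i : S) :
    ∑' k : ℕ, γ ^ k * (m ᵥ* (T ^ k)) i =
      m i + γ * ∑ j, (∑' k : ℕ, γ ^ k * (m ᵥ* (T ^ k)) j) * T j i := by
  have hs := summable_discounted_vecMul hT h0 h1 m
  rw [(hs i).tsum_eq_zero_add]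
  congr 1
  · simp
  · simp_rw [← tsum_mul_right]
    rw [← Summable.tsum_finsetSum fun j _ => (hs j).mul_right _, ← tsum_mul_left]
    refine tsum_congr fun k => ?_
    rw [_root_.pow_succ T, ← vecMul_vecMul, vecMul, dotProduct, pow_succ, mul_comm (γ ^ k),
      mul_assoc, Finset.mul_sum]
    congr 1
    exact Finset.sum_congr rfl fun j _ => by ring

/-- A stochastic matrix contracts the sup norm, so the discounted term is absorbed on the left. All
bounds on values, their differences and their derivatives come from here, with different sources
`b`. -/
theorem norm_le_of_discounted_mulVec_eq (hT : T ∈ rowStochastic ℝ S) {γ : ℝ} (h0 : 0 ≤ γ)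
    {v b : S → ℝ} (h : ∀ i, v i = b i + γ * ∑ j, T i j * v j) : (1 - γ) * ‖v‖ ≤ ‖b‖ := by
  have e : v = b + γ • (T *ᵥ v) := by funext i; simpa [mulVec, dotProduct] using h i
  have h2 : ‖v‖ ≤ ‖b‖ + γ * ‖v‖ := by
    calc ‖v‖ = ‖b + γ • (T *ᵥ v)‖ := by rw [← e]
      _ ≤ ‖b‖ + ‖γ • (T *ᵥ v)‖ := norm_add_le _ _
      _ ≤ ‖b‖ + γ * ‖v‖ := by
        rw [norm_smul, Real.norm_of_nonneg h0]
        gcongr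
        exact norm_mulVec_le_of_stochastic hT v
  linarith

/-- The dual bound: a stochastic matrix acting on measures contracts the `ℓ¹` norm. It serves the
visiting measures. -/
theorem sum_abs_le_of_discounted_vecMul_eq (hT : T ∈ rowStochastic ℝ S) {γ : ℝ} (h0 : 0 ≤ γ)
    {s m : S → ℝ} (h : ∀ i, s i = m i + γ * ∑ j, s j * T j i) :
    (1 - γ) * ∑ i, |s i| ≤ ∑ i, |m i| := by
  have h2 : ∑ i, |s i| ≤ ∑ i, |m i| + γ * ∑ i, |s i| := by
    calc ∑ i, |s i| ≤ ∑ i, (|m i| + γ * |(s ᵥ* T) i|) := Finset.sum_le_sum fun i _ => by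
          rw [h i]
          refine (abs_add_le _ _).trans (le_of_eq ?_)
          rw [abs_mul, abs_of_nonneg h0, vecMul, dotProduct]
      _ = ∑ i, |m i| + γ * ∑ i, |(s ᵥ* T) i| := by
          rw [Finset.sum_add_distrib, Finset.mul_sum]
      _ ≤ _ := by
          have := mul_le_mul_of_nonneg_left (sum_abs_vecMul_le_of_stochastic hT s) h0
          linarith
  linarith

theorem isUnit_one_sub_discounted (hT : T ∈ rowStochastic ℝ S) {γ : ℝ} (h0 : 0 ≤ γ) (h1 : γ < 1) :
    IsUnit (1 - γ • T) := by
  rw [← mulVec_injective_iff_isUnit]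
  intro v w hvw
  have h : (1 - γ • T) *ᵥ (v - w) = 0 := by rw [mulVec_sub, sub_eq_zero]; exact hvw
  rw [sub_mulVec, one_mulVec, smul_mulVec] at h
  have := norm_le_of_discounted_mulVec_eq hT h0 (v := v - w) (b := 0) fun i => by
    have := congrFun h i
    simp only [Pi.sub_apply, Pi.smul_apply, smul_eq_mul, Pi.zero_apply, mulVec, dotProduct] at this ⊢
    linarith
  rw [norm_zero] at this
  have h3 : ‖v - w‖ ≤ 0 := by
    by_contra! hlt
    have : 0 < (1 - γ) * ‖v - w‖ := mul_pos (by linarith) hlt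
    linarith
  exact sub_eq_zero.1 (norm_le_zero_iff.1 h3)

/-- A stationary law makes the discounted transition operator dissipative. -/
theorem stationary_dissipative {π : S → ℝ} (hπ : IsStationary T π) (hT : T ∈ rowStochastic ℝ S)
    {γ : ℝ} (h0 : 0 ≤ γ) (φ : S → ℝ) :
    ∑ i, φ i * ((γ * ∑ j, T i j * φ j - φ i) * π i) ≤ -(1 - γ) * ∑ i, π i * φ i ^ 2 := by
  -- Apply `ab ≤ (a² + b²)/2` under the weights `π i * T i j`, both of whose marginals are `π` by
  -- stationarity.
  have h1 : ∑ i, π i * (φ i * ∑ j, T i j * φ j) ≤ ∑ i, π i * φ i ^ 2 := by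
    have e2 : ∑ i, ∑ j, π i * T i j * φ j ^ 2 = ∑ j, π j * φ j ^ 2 := by
      rw [Finset.sum_comm]
      refine Finset.sum_congr rfl fun j _ => ?_
      rw [← Finset.sum_mul]
      congr 1
      simpa [vecMul, dotProduct] using congrFun hπ.stationary j
    have e1 : ∑ i, ∑ j, π i * T i j * φ i ^ 2 = ∑ j, π j * φ j ^ 2 := by
      refine Finset.sum_congr rfl fun i _ => ?_
      rw [← Finset.sum_mul, ← Finset.mul_sum, sum_row_of_mem_rowStochastic hT, mul_one]
    calc ∑ i, π i * (φ i * ∑ j, T i j * φ j)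
        = ∑ i, ∑ j, π i * T i j * (φ i * φ j) := by
          refine Finset.sum_congr rfl fun i _ => ?_
          rw [Finset.mul_sum, Finset.mul_sum]
          exact Finset.sum_congr rfl fun j _ => by ring
      _ ≤ ∑ i, ∑ j, (π i * T i j * φ i ^ 2 / 2 + π i * T i j * φ j ^ 2 / 2) := by
          refine Finset.sum_le_sum fun i _ => Finset.sum_le_sum fun j _ => ?_
          have := mul_nonneg (hπ.nonneg i) (nonneg_of_mem_rowStochastic hT (i := i) (j := j))
          nlinarith [mul_nonneg this (sq_nonneg (φ i - φ j))]
      _ = ∑ i, π i * φ i ^ 2 := by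
          simp_rw [Finset.sum_add_distrib, ← Finset.sum_div]
          rw [e1, e2]; ring
  have e : ∑ i, φ i * ((γ * ∑ j, T i j * φ j - φ i) * π i) =
      γ * ∑ i, π i * (φ i * ∑ j, T i j * φ j) - ∑ i, π i * φ i ^ 2 := by
    rw [Finset.mul_sum, ← Finset.sum_sub_distrib]
    exact Finset.sum_congr rfl fun i _ => by ring
  rw [e]
  nlinarith [mul_le_mul_of_nonneg_left h1 h0]

theorem stationary_vecMul_pow {π : S → ℝ} (hπ : IsStationary T π) (n : ℕ) :
    π ᵥ* (T ^ n) = π := by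
  induction n with
  | zero => simp
  | succ n ih => rw [pow_succ, ← vecMul_vecMul, ih, hπ.stationary]

theorem pow_le_pow_entrywise {U : Matrix S S ℝ} {ε : ℝ} (hε : 0 ≤ ε) (hU : ∀ i j, 0 ≤ U i j)
    (h : ∀ i j, ε * U i j ≤ T i j) (n : ℕ) :
    (∀ i j, 0 ≤ (U ^ n) i j) ∧ ∀ i j, ε ^ n * (U ^ n) i j ≤ (T ^ n) i j := by
  induction n with
  | zero => exact ⟨fun i j => by rw [pow_zero, one_apply]; split_ifs <;> norm_num, by simp⟩
  | succ n ih =>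
    refine ⟨fun i j => ?_, fun i j => ?_⟩
    · rw [pow_succ, mul_apply]
      exact Finset.sum_nonneg fun k _ => mul_nonneg (ih.1 i k) (hU k j)
    · rw [pow_succ U, pow_succ T, mul_apply, mul_apply, Finset.mul_sum]
      refine Finset.sum_le_sum fun k _ => ?_
      calc ε ^ (n + 1) * ((U ^ n) i k * U k j) = (ε ^ n * (U ^ n) i k) * (ε * U k j) := by ring
        _ ≤ (T ^ n) i k * T k j := mul_le_mul (ih.2 i k) (h k j) (mul_nonneg hε (hU k j))
          ((mul_nonneg (pow_nonneg hε n) (ih.1 i k)).trans (ih.2 i k))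

/-- A chain that dominates a multiple `ε` of an irreducible chain has a stationary law bounded below
by a power of `ε`. -/
theorem stationary_lower_bound [Nonempty S] {U : Matrix S S ℝ} (hU : ∀ i j, 0 ≤ U i j)
    (hirr : IsIrreducibleChain U) :
    ∃ c : ℝ, 0 < c ∧ ∃ n : ℕ, ∀ ε : ℝ, 0 < ε → ε ≤ 1 → ∀ T : Matrix S S ℝ,
      (∀ i j, ε * U i j ≤ T i j) → ∀ π, IsStationary T π → ∀ j, c * ε ^ n ≤ π j := by
  choose n hn using hirr
  -- A common exponent for all pairs is enough: since `ε ≤ 1`, a larger exponent only weakens the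
  -- bound.
  obtain ⟨N, hN⟩ := (Set.finite_range (fun q : S × S => n q.1 q.2)).bddAbove
  obtain ⟨q, hq⟩ := Finite.exists_min (fun q : S × S => (U ^ n q.1 q.2) q.1 q.2)
  have hcard : (0 : ℝ) < Fintype.card S := Nat.cast_pos.2 Fintype.card_pos
  refine ⟨(Fintype.card S : ℝ)⁻¹ * (U ^ n q.1 q.2) q.1 q.2, mul_pos (inv_pos.2 hcard) (hn _ _), N,
    fun ε hε hε1 T hT π hπ j => ?_⟩
  -- Some state carries at least the average mass. Mass flows from it to `j` in `n i j` steps, and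
  -- stationarity equates the outcome with `π j`.
  obtain ⟨i, hi⟩ : ∃ i, (Fintype.card S : ℝ)⁻¹ ≤ π i := by
    by_contra! hlt
    have := Finset.sum_lt_sum_of_nonempty Finset.univ_nonempty fun i (_ : i ∈ Finset.univ) => hlt i
    rw [hπ.sum_eq_one] at this
    simp [hcard.ne'] at this
  have hpow := pow_le_pow_entrywise hε.le hU hT (n i j)
  have hs := congrFun (stationary_vecMul_pow hπ (n i j)) j
  rw [vecMul, dotProduct] at hs
  have hnn : ∀ k, 0 ≤ (T ^ n i j) k j := fun k =>
    (mul_nonneg (pow_nonneg hε.le _) (hpow.1 k j)).trans (hpow.2 k j)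
  calc (Fintype.card S : ℝ)⁻¹ * (U ^ n q.1 q.2) q.1 q.2 * ε ^ N
      = (Fintype.card S : ℝ)⁻¹ * (ε ^ N * (U ^ n q.1 q.2) q.1 q.2) := by ring
    _ ≤ π i * (ε ^ (n i j) * (U ^ n i j) i j) := by
        refine mul_le_mul hi (mul_le_mul ?_ (hq (i, j)) (hn _ _).le (by positivity))
          (mul_nonneg (by positivity) (hn _ _).le) (hπ.nonneg i)
        exact pow_le_pow_of_le_one hε.le hε1 (hN ⟨(i, j), rfl⟩)
    _ ≤ π i * (T ^ n i j) i j := mul_le_mul_of_nonneg_left (hpow.2 i j) (hπ.nonneg i)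
    _ ≤ ∑ k, π k * (T ^ n i j) k j :=
        Finset.single_le_sum (f := fun k => π k * (T ^ n i j) k j)
          (fun k _ => mul_nonneg (hπ.nonneg k) (hnn k)) (Finset.mem_univ i)
    _ = π j := hs

end StochasticMatrices

/-! ### Value functions, visiting measures and performance difference -/

section Values

open Matrix


variable {X A : Type*} [Fintype A]

theorem IsPolicy.le_one {f : X × A → ℝ} (hf : IsPolicy f) (ξ : X × A) : f ξ ≤ 1 := by
  rw [← hf.sum_eq_one ξ.1]
  exact Finset.single_le_sum (f := fun a => f (ξ.1, a)) (fun a _ => hf.nonneg _)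
    (Finset.mem_univ ξ.2)

theorem IsPolicy.abs_le_one {f : X × A → ℝ} (hf : IsPolicy f) (ξ : X × A) : |f ξ| ≤ 1 := by
  rw [abs_of_nonneg (hf.nonneg ξ)]; exact hf.le_one ξ

variable [Fintype X]

theorem MDP.nonempty (M : MDP X A) : Nonempty (X × A) := by
  by_contra h
  rw [not_nonempty_iff] at h
  have := M.ρ₀_sum
  simp at this

theorem MDP.one_sub_γ_pos (M : MDP X A) : 0 < 1 - M.γ := sub_pos.2 M.γ_lt_one

theorem MDP.p_le_one (M : MDP X A) (x : X) (a : A) (y : X) : M.p x a y ≤ 1 := by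
  rw [← M.p_sum x a]
  exact Finset.single_le_sum (fun y _ => M.p_nonneg x a y) (Finset.mem_univ y)

theorem MDP.initState_nonneg (M : MDP X A) (x : X) : 0 ≤ M.initState x :=
  Finset.sum_nonneg fun _ _ => M.ρ₀_nonneg _

theorem MDP.initState_sum (M : MDP X A) : ∑ x, M.initState x = 1 := by
  rw [← M.ρ₀_sum, Fintype.sum_prod_type]
  rfl

theorem MDP.initState_le_one (M : MDP X A) (x : X) : M.initState x ≤ 1 := by
  rw [← M.initState_sum]
  exact Finset.single_le_sum (fun y _ => M.initState_nonneg y) (Finset.mem_univ x)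

theorem MDP.norm_r_le (M : MDP X A) : ‖M.r‖ ≤ 1 :=
  (pi_norm_le_iff_of_nonneg zero_le_one).2 fun ξ => M.r_bound ξ

variable [DecidableEq X] [DecidableEq A]

theorem MDP.trans_mem (M : MDP X A) {f : X × A → ℝ} (hf : IsPolicy f) :
    M.trans f ∈ rowStochastic ℝ (X × A) := by
  refine mem_rowStochastic_iff_sum.2 ⟨fun ξ ξ' => mul_nonneg (M.p_nonneg _ _ _) (hf.nonneg _),
    fun ξ => ?_⟩
  simp only [MDP.trans, of_apply]
  rw [Fintype.sum_prod_type]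
  simp_rw [← Finset.mul_sum, hf.sum_eq_one, mul_one, M.p_sum]

theorem MDP.actionValue_eq (M : MDP X A) {f : X × A → ℝ} (hf : IsPolicy f) (ξ : X × A) :
    M.actionValue f ξ = M.r ξ + M.γ * ∑ ξ', M.trans f ξ ξ' * M.actionValue f ξ' :=
  discounted_mulVec_eq (M.trans_mem hf) M.γ_pos.le M.γ_lt_one M.r ξ

theorem MDP.norm_actionValue_le (M : MDP X A) {f : X × A → ℝ} (hf : IsPolicy f) :
    ‖M.actionValue f‖ ≤ (1 - M.γ)⁻¹ := by
  rw [← one_div, le_div_iff₀' M.one_sub_γ_pos]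
  exact (norm_le_of_discounted_mulVec_eq (M.trans_mem hf) M.γ_pos.le (M.actionValue_eq hf)).trans
    M.norm_r_le

theorem MDP.visiting_eq (M : MDP X A) {f : X × A → ℝ} (hf : IsPolicy f) (ξ : X × A) :
    M.visiting f ξ = M.initState ξ.1 * f ξ + M.γ * ∑ ζ, M.visiting f ζ * M.trans f ζ ξ :=
  discounted_vecMul_eq (M.trans_mem hf) M.γ_pos.le M.γ_lt_one (fun ξ => M.initState ξ.1 * f ξ) ξ

theorem MDP.sum_abs_visiting_le (M : MDP X A) {f : X × A → ℝ} (hf : IsPolicy f) :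
    ∑ ξ, |M.visiting f ξ| ≤ (1 - M.γ)⁻¹ := by
  rw [← one_div, le_div_iff₀' M.one_sub_γ_pos]
  refine (sum_abs_le_of_discounted_vecMul_eq (M.trans_mem hf) M.γ_pos.le
    (M.visiting_eq hf)).trans (le_of_eq ?_)
  rw [Fintype.sum_prod_type]
  simp_rw [abs_mul, abs_of_nonneg (hf.nonneg _), abs_of_nonneg (M.initState_nonneg _),
    ← Finset.mul_sum, hf.sum_eq_one, mul_one, M.initState_sum]

theorem MDP.abs_visiting_le (M : MDP X A) {f : X × A → ℝ} (hf : IsPolicy f) (ξ : X × A) :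
    |M.visiting f ξ| ≤ (1 - M.γ)⁻¹ :=
  (Finset.single_le_sum (f := fun ξ => |M.visiting f ξ|) (fun _ _ => abs_nonneg _)
    (Finset.mem_univ ξ)).trans (M.sum_abs_visiting_le hf)

/-- Discounted visiting measure of states. -/
def MDP.stateVisiting (M : MDP X A) (f : X × A → ℝ) (x : X) : ℝ :=
  M.initState x + M.γ * ∑ ζ : X × A, M.visiting f ζ * M.p ζ.1 ζ.2 x

/-- Every action, including the initial one, is drawn from `f`, so the policy factors out of the
fixed-point equation. -/
theorem MDP.visiting_eq_stateVisiting_mul (M : MDP X A) {f : X × A → ℝ} (hf : IsPolicy f)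
    (ξ : X × A) : M.visiting f ξ = M.stateVisiting f ξ.1 * f ξ := by
  rw [M.visiting_eq hf, MDP.stateVisiting, add_mul, mul_assoc, Finset.sum_mul]
  simp [MDP.trans, mul_assoc]

/-- Subtracting the two Bellman equations, the difference solves the equation of `g` with source `γ
(T_f - T_g) V^f`, and the contraction bound applies. -/
theorem MDP.actionValue_lipschitz (M : MDP X A) {f g : X × A → ℝ} (hf : IsPolicy f)
    (hg : IsPolicy g) :
    ‖M.actionValue f - M.actionValue g‖ ≤
      (1 - M.γ)⁻¹ * (Fintype.card (X × A) * (1 - M.γ)⁻¹) * ‖f - g‖ := by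
  set b : X × A → ℝ := fun ξ => M.γ * ∑ ξ', (M.trans f ξ ξ' - M.trans g ξ ξ') * M.actionValue f ξ'
    with hb
  have hfix : ∀ ξ, (M.actionValue f - M.actionValue g) ξ = b ξ + M.γ *
      ∑ ξ', M.trans g ξ ξ' * (M.actionValue f - M.actionValue g) ξ' := by
    intro ξ
    rw [Pi.sub_apply, M.actionValue_eq hf, M.actionValue_eq hg, hb, ← mul_add,
      ← Finset.sum_add_distrib, add_sub_add_left_eq_sub, ← mul_sub, ← Finset.sum_sub_distrib]
    congr 1
    exact Finset.sum_congr rfl fun ξ' _ => by rw [Pi.sub_apply]; ring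
  have h1 := norm_le_of_discounted_mulVec_eq (M.trans_mem hg) M.γ_pos.le hfix
  have h2 : ‖b‖ ≤ Fintype.card (X × A) * (1 - M.γ)⁻¹ * ‖f - g‖ := by
    have hγ := inv_nonneg.2 M.one_sub_γ_pos.le
    refine (pi_norm_le_iff_of_nonneg (by positivity)).2 fun ξ => ?_
    rw [hb, Real.norm_eq_abs, abs_mul, abs_of_pos M.γ_pos]
    refine (mul_le_of_le_one_left (abs_nonneg _) M.γ_lt_one.le).trans ?_
    refine (Finset.abs_sum_le_sum_abs _ _).trans ?_
    rw [mul_assoc, ← nsmul_eq_mul]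
    refine Finset.sum_le_card_nsmul _ _ _ fun ξ' _ => ?_
    simp only [MDP.trans, of_apply]
    rw [← mul_sub, abs_mul, abs_mul, abs_of_nonneg (M.p_nonneg _ _ _), mul_comm (1 - M.γ)⁻¹]
    refine mul_le_mul ?_ ((norm_le_pi_norm _ ξ').trans (M.norm_actionValue_le hf)) (abs_nonneg _)
      (norm_nonneg _)
    exact (mul_le_of_le_one_left (abs_nonneg _) (M.p_le_one _ _ _)).trans (norm_le_pi_norm (f - g) ξ')
  rw [mul_assoc, ← inv_mul_le_iff₀ (inv_pos.2 M.one_sub_γ_pos), inv_inv]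
  exact h1.trans h2

/-- The difference solves the visiting equation of `g` with source the state visiting measure of `f`
times `f - g`. -/
theorem MDP.visiting_lipschitz (M : MDP X A) {f g : X × A → ℝ} (hf : IsPolicy f)
    (hg : IsPolicy g) (ξ : X × A) :
    |M.visiting f ξ - M.visiting g ξ| ≤
      (1 - M.γ)⁻¹ * (Fintype.card (X × A) * (1 + (1 - M.γ)⁻¹)) * ‖f - g‖ := by
  set b : X × A → ℝ := fun ξ => M.stateVisiting f ξ.1 * (f ξ - g ξ) with hb
  have hfix : ∀ ξ, (M.visiting f - M.visiting g) ξ = b ξ + M.γ *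
      ∑ ζ, (M.visiting f - M.visiting g) ζ * M.trans g ζ ξ := by
    intro ξ
    have e : M.γ * ∑ ζ, (M.visiting f - M.visiting g) ζ * M.trans g ζ ξ =
        M.γ * ∑ ζ, M.visiting f ζ * M.trans g ζ ξ - M.γ * ∑ ζ, M.visiting g ζ * M.trans g ζ ξ := by
      simp_rw [Pi.sub_apply, sub_mul, Finset.sum_sub_distrib, mul_sub]
    have e2 : M.γ * ∑ ζ, M.visiting f ζ * M.trans g ζ ξ =
        (M.stateVisiting f ξ.1 - M.initState ξ.1) * g ξ := by
      rw [MDP.stateVisiting, add_sub_cancel_left, mul_assoc, Finset.sum_mul]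
      simp [MDP.trans, mul_assoc]
    rw [e, e2, Pi.sub_apply, M.visiting_eq_stateVisiting_mul hf, M.visiting_eq hg, hb]
    ring
  have h1 := sum_abs_le_of_discounted_vecMul_eq (M.trans_mem hg) M.γ_pos.le hfix
  have h2 : ∑ ξ, |b ξ| ≤ Fintype.card (X × A) * (1 + (1 - M.γ)⁻¹) * ‖f - g‖ := by
    rw [mul_assoc, ← nsmul_eq_mul]
    refine Finset.sum_le_card_nsmul _ _ _ fun ξ _ => ?_
    rw [hb, abs_mul]
    refine mul_le_mul ?_ (norm_le_pi_norm (f - g) ξ) (abs_nonneg _)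
      (by have := inv_nonneg.2 M.one_sub_γ_pos.le; positivity)
    refine (abs_add_le _ _).trans (add_le_add ?_ ?_)
    · rw [abs_of_nonneg (M.initState_nonneg _)]; exact M.initState_le_one _
    · rw [abs_mul, abs_of_pos M.γ_pos]
      refine (mul_le_of_le_one_left (abs_nonneg _) M.γ_lt_one.le).trans ?_
      refine (Finset.abs_sum_le_sum_abs _ _).trans (le_trans ?_ (M.sum_abs_visiting_le hf))
      refine Finset.sum_le_sum fun ζ _ => ?_
      rw [abs_mul, abs_of_nonneg (M.p_nonneg _ _ _)]
      exact mul_le_of_le_one_right (abs_nonneg _) (M.p_le_one _ _ _)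
  rw [mul_assoc, ← inv_mul_le_iff₀ (inv_pos.2 M.one_sub_γ_pos), inv_inv]
  refine le_trans (mul_le_mul_of_nonneg_left ?_ M.one_sub_γ_pos.le) (h1.trans h2)
  exact Finset.single_le_sum (f := fun ξ => |(M.visiting f - M.visiting g) ξ|)
    (fun _ _ => abs_nonneg _) (Finset.mem_univ ξ)

theorem MDP.objective_eq_sum (M : MDP X A) (f : X × A → ℝ) :
    M.objective f = ∑ ξ : X × A, M.initState ξ.1 * f ξ * M.actionValue f ξ := by
  rw [Fintype.sum_prod_type]
  simp only [MDP.objective, MDP.stateValue, Finset.mul_sum, mul_assoc]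

/-- Performance difference identity. -/
theorem MDP.objective_sub (M : MDP X A) {f g : X × A → ℝ} (hf : IsPolicy f) (hg : IsPolicy g) :
    M.objective g - M.objective f =
      ∑ ξ : X × A, M.stateVisiting g ξ.1 * (g ξ - f ξ) * M.actionValue f ξ := by
  -- Substitute `r = V^h - γ T_h V^h` and move `T_h` onto the visiting measure of `k`. Taking `h = k
  -- = g` and then `h = f`, `k = g` gives two expressions of the same quantity.
  have pair : ∀ {h k : X × A → ℝ} (_ : IsPolicy h) (_ : IsPolicy k),
      ∑ ξ, M.visiting k ξ * M.r ξ =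
      ∑ ξ, (M.visiting k ξ - (M.stateVisiting k ξ.1 - M.initState ξ.1) * h ξ) *
        M.actionValue h ξ := by
    intro h k hh hk
    have e : ∀ ξ : X × A, (M.stateVisiting k ξ.1 - M.initState ξ.1) * h ξ =
        M.γ * ∑ ζ, M.visiting k ζ * M.trans h ζ ξ := by
      intro ξ
      rw [MDP.stateVisiting, add_sub_cancel_left, mul_assoc, Finset.sum_mul]
      simp [MDP.trans, mul_assoc]
    simp_rw [e, sub_mul, Finset.sum_sub_distrib]
    rw [eq_sub_iff_add_eq]
    have e2 : ∑ ξ, M.γ * (∑ ζ, M.visiting k ζ * M.trans h ζ ξ) * M.actionValue h ξ =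
        ∑ ζ, M.visiting k ζ * (M.γ * ∑ ξ, M.trans h ζ ξ * M.actionValue h ξ) := by
      simp_rw [Finset.mul_sum, Finset.sum_mul]
      rw [Finset.sum_comm]
      exact Finset.sum_congr rfl fun _ _ => Finset.sum_congr rfl fun _ _ => by ring
    rw [e2, ← Finset.sum_add_distrib]
    refine Finset.sum_congr rfl fun ζ _ => ?_
    rw [← mul_add, ← M.actionValue_eq hh]
  have h1 : M.objective g = ∑ ξ, M.visiting g ξ * M.r ξ := by
    rw [pair hg hg, M.objective_eq_sum]
    refine Finset.sum_congr rfl fun ξ _ => ?_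
    rw [M.visiting_eq_stateVisiting_mul hg]
    ring
  rw [h1, pair hf hg, M.objective_eq_sum, ← Finset.sum_sub_distrib]
  refine Finset.sum_congr rfl fun ξ _ => ?_
  rw [M.visiting_eq_stateVisiting_mul hg]
  ring

theorem MDP.stateVisiting_lipschitz (M : MDP X A) {f g : X × A → ℝ} (hf : IsPolicy f)
    (hg : IsPolicy g) (x : X) :
    |M.stateVisiting f x - M.stateVisiting g x| ≤
      Fintype.card (X × A) *
        ((1 - M.γ)⁻¹ * (Fintype.card (X × A) * (1 + (1 - M.γ)⁻¹)) * ‖f - g‖) := by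
  rw [MDP.stateVisiting, MDP.stateVisiting, add_sub_add_left_eq_sub, ← mul_sub,
    ← Finset.sum_sub_distrib, abs_mul, abs_of_pos M.γ_pos]
  refine (mul_le_of_le_one_left (abs_nonneg _) M.γ_lt_one.le).trans ?_
  refine (Finset.abs_sum_le_sum_abs _ _).trans ?_
  rw [← nsmul_eq_mul]
  refine Finset.sum_le_card_nsmul _ _ _ fun ζ _ => ?_
  rw [← sub_mul, abs_mul, abs_of_nonneg (M.p_nonneg _ _ _)]
  exact (mul_le_of_le_one_right (abs_nonneg _) (M.p_le_one _ _ _)).trans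
    (M.visiting_lipschitz hf hg ζ)

end Values

/-! ### The softmax policy and centring -/

section Softmax

variable {X A : Type*} [Fintype A]

theorem softmax_denom_pos [Nonempty A] (P : X × A → ℝ) (x : X) : 0 < ∑ a, Real.exp (P (x, a)) :=
  Finset.sum_pos (fun _ _ => Real.exp_pos _) Finset.univ_nonempty

theorem softmax_isPolicy [Nonempty A] (P : X × A → ℝ) : IsPolicy (softmax P) where
  nonneg ξ := div_nonneg (Real.exp_pos _).le (softmax_denom_pos P ξ.1).le
  sum_eq_one x := by
    simp only [softmax]
    rw [← Finset.sum_div, div_self (softmax_denom_pos P x).ne']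

/-- The derivative of the softmax policy in the logits. -/
def softmaxDeriv (P : X × A → ℝ) (ξ : X × A) : (X × A → ℝ) →L[ℝ] ℝ :=
  softmax P ξ • (ContinuousLinearMap.proj ξ -
    ∑ b, softmax P (ξ.1, b) • ContinuousLinearMap.proj (R := ℝ) (φ := fun _ : X × A => ℝ) (ξ.1, b))

theorem softmaxDeriv_apply (P H : X × A → ℝ) (ξ : X × A) :
    softmaxDeriv P ξ H = softmax P ξ * (H ξ - ∑ b, softmax P (ξ.1, b) * H (ξ.1, b)) := by
  simp [softmaxDeriv]

theorem softmax_hasFDerivAt [Fintype X] [Nonempty A] (P : X × A → ℝ) (ξ : X × A) :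
    HasFDerivAt (fun P' : X × A → ℝ => softmax P' ξ) (softmaxDeriv P ξ) P := by
  have hp : ∀ ζ : X × A, HasFDerivAt (fun P' : X × A → ℝ => Real.exp (P' ζ))
      (Real.exp (P ζ) • ContinuousLinearMap.proj (R := ℝ) (φ := fun _ : X × A => ℝ) ζ) P :=
    fun ζ => (hasFDerivAt_apply ζ P).exp
  have hs : HasFDerivAt (fun P' : X × A → ℝ => ∑ b, Real.exp (P' (ξ.1, b)))
      (∑ b, Real.exp (P (ξ.1, b)) •
        ContinuousLinearMap.proj (R := ℝ) (φ := fun _ : X × A => ℝ) (ξ.1, b)) P :=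
    HasFDerivAt.fun_sum fun b _ => hp (ξ.1, b)
  have hne := (softmax_denom_pos P ξ.1).ne'
  have := (hp ξ).mul ((hasDerivAt_inv hne).comp_hasFDerivAt P hs)
  refine this.congr_fderiv ?_
  refine ContinuousLinearMap.ext fun H => ?_
  rw [softmaxDeriv_apply]
  simp only [softmax, _root_.add_apply, Function.comp_apply, _root_.smul_apply,
    _root_.sum_apply, ContinuousLinearMap.proj_apply, smul_eq_mul]
  simp_rw [div_mul_eq_mul_div]
  rw [← Finset.sum_div]
  field_simp
  ring

theorem abs_sum_policy_mul_le [Fintype X] {f : X × A → ℝ} (hf : IsPolicy f) (H : X × A → ℝ)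
    (x : X) : |∑ b, f (x, b) * H (x, b)| ≤ ‖H‖ := by
  calc |∑ b, f (x, b) * H (x, b)| ≤ ∑ b, |f (x, b) * H (x, b)| := Finset.abs_sum_le_sum_abs _ _
    _ ≤ ∑ b, f (x, b) * ‖H‖ := Finset.sum_le_sum fun b _ => by
        rw [abs_mul, abs_of_nonneg (hf.nonneg _)]
        exact mul_le_mul_of_nonneg_left (norm_le_pi_norm H _) (hf.nonneg _)
    _ = ‖H‖ := by rw [← Finset.sum_mul, hf.sum_eq_one, one_mul]

theorem abs_softmaxDeriv_le [Fintype X] [Nonempty A] (P H : X × A → ℝ) (ξ : X × A) :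
    |softmaxDeriv P ξ H| ≤ 2 * ‖H‖ := by
  have hf := softmax_isPolicy P
  rw [softmaxDeriv_apply, abs_mul]
  refine (mul_le_of_le_one_left (abs_nonneg _) (hf.abs_le_one ξ)).trans ?_
  refine (abs_sub _ _).trans ?_
  have h1 : |H ξ| ≤ ‖H‖ := norm_le_pi_norm H ξ
  linarith [abs_sum_policy_mul_le hf H ξ.1]

theorem softmax_lipschitz [Fintype X] [Nonempty A] (P P' : X × A → ℝ) :
    ‖softmax P - softmax P'‖ ≤ 2 * ‖P - P'‖ := by
  refine (pi_norm_le_iff_of_nonneg (by positivity)).2 fun ξ => ?_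
  exact convex_univ.norm_image_sub_le_of_norm_hasFDerivWithin_le
    (f := fun P : X × A → ℝ => softmax P ξ) (f' := fun P => softmaxDeriv P ξ)
    (fun Q _ => (softmax_hasFDerivAt Q ξ).hasFDerivWithinAt)
    (fun Q _ => ContinuousLinearMap.opNorm_le_bound _ zero_le_two
      fun H => abs_softmaxDeriv_le Q H ξ) (Set.mem_univ P') (Set.mem_univ P)

/-- A product is differentiable at a zero of a differentiable factor if the other factor is
continuous there. -/
theorem hasFDerivAt_mul_of_vanishing {E : Type*} [NormedAddCommGroup E] [NormedSpace ℝ E]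
    {u h : E → ℝ} {h' : E →L[ℝ] ℝ} {x : E} (hu : ContinuousAt u x) (hh : HasFDerivAt h h' x)
    (h0 : h x = 0) : HasFDerivAt (fun y => u y * h y) (u x • h') x := by
  have h1 : (fun y => (u y - u x) * h y) =o[𝓝 x] fun y => y - x := by
    have a : (fun y => u y - u x) =o[𝓝 x] fun _ => (1 : ℝ) := by
      rw [Asymptotics.isLittleO_one_iff]
      exact tendsto_sub_nhds_zero_iff.2 hu.tendsto
    have b : h =O[𝓝 x] fun y => y - x := by
      simpa [h0] using hh.isBigO_sub
    have := a.mul_isBigO b.norm_right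
    simpa using this
  have h2 := (hh.const_mul (u x)).isLittleO
  rw [hasFDerivAt_iff_isLittleO]
  refine (h1.add h2).congr_left fun y => ?_
  simp [h0]
  ring

/-- Subtract the total mass of `h` at each state, distributed according to `f`. -/
def center (f h : X × A → ℝ) (ξ : X × A) : ℝ := h ξ - f ξ * ∑ b, h (ξ.1, b)

/-- Centring is the adjoint of subtracting the policy average. Both the actor field and the
derivative of `J` take the form `∑ H * center f h`, which makes them comparable. -/
theorem sum_mul_sub_policy_average [Fintype X] (f h H : X × A → ℝ) :
    ∑ ξ : X × A, h ξ * (H ξ - ∑ b, f (ξ.1, b) * H (ξ.1, b)) = ∑ ξ, H ξ * center f h ξ := by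
  simp only [center, mul_sub, Finset.sum_sub_distrib]
  congr 1
  · exact Finset.sum_congr rfl fun _ _ => mul_comm _ _
  · rw [Fintype.sum_prod_type, Fintype.sum_prod_type]
    refine Finset.sum_congr rfl fun x _ => ?_
    simp only
    rw [← Finset.sum_mul, mul_comm, Finset.sum_mul]
    exact Finset.sum_congr rfl fun b _ => by ring

theorem norm_center_sub_le [Fintype X] {f g h k : X × A → ℝ} (hg : IsPolicy g) :
    ‖center f h - center g k‖ ≤
      (1 + Fintype.card A) * ‖h - k‖ + Fintype.card A * ‖h‖ * ‖f - g‖ := by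
  refine (pi_norm_le_iff_of_nonneg (by positivity)).2 fun ξ => ?_
  have e : (center f h - center g k) ξ =
      (h ξ - k ξ) - ((f ξ - g ξ) * ∑ b, h (ξ.1, b) + g ξ * ∑ b, (h (ξ.1, b) - k (ξ.1, b))) := by
    rw [Finset.sum_sub_distrib, Pi.sub_apply, center, center]; ring
  have hsum : ∀ v : X × A → ℝ, |∑ b, v (ξ.1, b)| ≤ Fintype.card A * ‖v‖ := fun v => by
    refine (Finset.abs_sum_le_sum_abs _ _).trans ?_
    rw [← nsmul_eq_mul]
    exact Finset.sum_le_card_nsmul _ _ _ fun b _ => norm_le_pi_norm v _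
  have h1 : |h ξ - k ξ| ≤ ‖h - k‖ := norm_le_pi_norm (h - k) ξ
  have h2 : |(f ξ - g ξ) * ∑ b, h (ξ.1, b)| ≤ ‖f - g‖ * (Fintype.card A * ‖h‖) := by
    rw [abs_mul]
    exact mul_le_mul (norm_le_pi_norm (f - g) ξ) (hsum h) (abs_nonneg _) (norm_nonneg _)
  have h3 : |g ξ * ∑ b, (h (ξ.1, b) - k (ξ.1, b))| ≤ Fintype.card A * ‖h - k‖ := by
    rw [abs_mul]
    exact (mul_le_of_le_one_left (abs_nonneg _) (hg.abs_le_one ξ)).trans (hsum (h - k))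
  rw [e, Real.norm_eq_abs]
  refine (abs_sub _ _).trans ?_
  have := abs_add_le ((f ξ - g ξ) * ∑ b, h (ξ.1, b)) (g ξ * ∑ b, (h (ξ.1, b) - k (ξ.1, b)))
  nlinarith

end Softmax

/-! ### The policy gradient and its regularity -/

section PolicyGradient

variable {X A : Type*} [Fintype X] [Fintype A]

theorem MDP.nonempty_action (M : MDP X A) : Nonempty A := M.nonempty.map Prod.snd

variable [DecidableEq X] [DecidableEq A]

theorem MDP.stateVisiting_softmax_continuous (M : MDP X A) (x : X) :
    Continuous fun P : X × A → ℝ => M.stateVisiting (softmax P) x := by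
  have := M.nonempty_action
  set C : ℝ := Fintype.card (X × A) * ((1 - M.γ)⁻¹ * (Fintype.card (X × A) * (1 + (1 - M.γ)⁻¹)))
    with hC
  have hC0 : 0 ≤ C := by have := inv_nonneg.2 M.one_sub_γ_pos.le; positivity
  refine (LipschitzWith.of_dist_le_mul (K := Real.toNNReal (C * 2)) fun P P' => ?_).continuous
  rw [dist_eq_norm, dist_eq_norm, Real.norm_eq_abs]
  refine (M.stateVisiting_lipschitz (softmax_isPolicy P) (softmax_isPolicy P') x).trans ?_
  have := mul_le_mul_of_nonneg_left (softmax_lipschitz P P') hC0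
  rw [Real.coe_toNNReal _ (by positivity)]
  rw [hC] at this ⊢
  nlinarith

/-- The gradient of the objective in the logits. -/
def MDP.softmaxGradient (M : MDP X A) (P : X × A → ℝ) : X × A → ℝ :=
  center (softmax P) fun ξ => M.visiting (softmax P) ξ * M.actionValue (softmax P) ξ

/-- Policy gradient theorem for the softmax parametrisation. -/
theorem MDP.objective_hasFDerivAt (M : MDP X A) (P : X × A → ℝ) :
    ∃ L : (X × A → ℝ) →L[ℝ] ℝ, (∀ H, L H = ∑ ξ, H ξ * M.softmaxGradient P ξ) ∧
      HasFDerivAt (fun P' : X × A → ℝ => M.objective (softmax P')) L P := by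
  have := M.nonempty_action
  -- By the performance difference identity this function is the objective. The factor `softmax P' -
  -- softmax P` vanishes at `P`, so the visiting measure need only be continuous there, not
  -- differentiable.
  have hd : HasFDerivAt (fun P' : X × A → ℝ => M.objective (softmax P) + ∑ ξ : X × A,
      M.stateVisiting (softmax P') ξ.1 *
        ((softmax P' ξ - softmax P ξ) * M.actionValue (softmax P) ξ))
      (∑ ξ : X × A, M.stateVisiting (softmax P) ξ.1 •
        (M.actionValue (softmax P) ξ • softmaxDeriv P ξ)) P := by
    refine (HasFDerivAt.fun_sum fun ξ _ => ?_).const_add _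
    refine hasFDerivAt_mul_of_vanishing (M.stateVisiting_softmax_continuous ξ.1).continuousAt
      (((softmax_hasFDerivAt P ξ).sub_const _).mul_const _) ?_
    simp
  refine ⟨_, fun H => ?_, hd.congr_of_eventuallyEq (Filter.Eventually.of_forall fun P' => ?_)⟩
  · rw [MDP.softmaxGradient, ← sum_mul_sub_policy_average]
    simp only [_root_.sum_apply, _root_.smul_apply, smul_eq_mul,
      softmaxDeriv_apply]
    refine Finset.sum_congr rfl fun ξ _ => ?_
    rw [M.visiting_eq_stateVisiting_mul (softmax_isPolicy P)]
    ring
  · simp only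
    rw [← sub_eq_iff_eq_add', M.objective_sub (softmax_isPolicy P) (softmax_isPolicy P')]
    simp only [mul_assoc]

theorem MDP.policyGradient_eq (M : MDP X A) (P : X × A → ℝ) :
    M.policyGradient P = M.softmaxGradient P := by
  obtain ⟨L, hL, hd⟩ := M.objective_hasFDerivAt P
  funext ξ
  rw [MDP.policyGradient, hd.fderiv, hL]
  simp [Pi.single_apply]

theorem MDP.norm_visiting_mul_sub_le (M : MDP X A) {f g V W : X × A → ℝ} (hf : IsPolicy f)
    (hg : IsPolicy g) :
    ‖(fun ξ => M.visiting f ξ * V ξ) - fun ξ => M.visiting g ξ * W ξ‖ ≤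
      (1 - M.γ)⁻¹ * ‖V - W‖ +
      (1 - M.γ)⁻¹ * (Fintype.card (X × A) * (1 + (1 - M.γ)⁻¹)) * ‖f - g‖ * ‖W‖ := by
  have hγ := inv_nonneg.2 M.one_sub_γ_pos.le
  refine (pi_norm_le_iff_of_nonneg (by positivity)).2 fun ξ => ?_
  have e : ((fun ξ => M.visiting f ξ * V ξ) - fun ξ => M.visiting g ξ * W ξ) ξ =
      M.visiting f ξ * (V ξ - W ξ) + (M.visiting f ξ - M.visiting g ξ) * W ξ := by
    simp only [Pi.sub_apply]; ring
  rw [e, Real.norm_eq_abs]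
  refine (abs_add_le _ _).trans (add_le_add ?_ ?_)
  · rw [abs_mul]
    exact mul_le_mul (M.abs_visiting_le hf ξ) (norm_le_pi_norm (V - W) ξ) (abs_nonneg _) hγ
  · rw [abs_mul]
    exact mul_le_mul (M.visiting_lipschitz hf hg ξ) (norm_le_pi_norm W ξ) (abs_nonneg _)
      (by positivity)

theorem MDP.norm_visiting_mul_actionValue_le (M : MDP X A) {f : X × A → ℝ} (hf : IsPolicy f) :
    ‖fun ξ => M.visiting f ξ * M.actionValue f ξ‖ ≤ (1 - M.γ)⁻¹ * (1 - M.γ)⁻¹ := by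
  have hγ := inv_nonneg.2 M.one_sub_γ_pos.le
  refine (pi_norm_le_iff_of_nonneg (by positivity)).2 fun ξ => ?_
  rw [norm_mul]
  exact mul_le_mul (M.abs_visiting_le hf ξ) ((norm_le_pi_norm _ ξ).trans (M.norm_actionValue_le hf))
    (norm_nonneg _) hγ

/-- Visiting measure, value and softmax are bounded and Lipschitz, and so is their centred product.
This feeds the Barbalat argument along the path of the actor. -/
theorem MDP.softmaxGradient_lipschitz (M : MDP X A) :
    ∃ L : ℝ, 0 ≤ L ∧ ∀ P P', ‖M.softmaxGradient P - M.softmaxGradient P'‖ ≤ L * ‖P - P'‖ := by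
  have := M.nonempty_action
  have hγ := inv_nonneg.2 M.one_sub_γ_pos.le
  set q := (1 - M.γ)⁻¹ with hq
  set C₁ := q * (Fintype.card (X × A) * q) with hC₁
  set C₂ := q * (Fintype.card (X × A) * (1 + q)) with hC₂
  set N : ℝ := (Fintype.card A : ℝ) with hN
  have hC₁0 : 0 ≤ C₁ := by positivity
  have hC₂0 : 0 ≤ C₂ := by positivity
  have hN0 : 0 ≤ N := by positivity
  refine ⟨((1 + N) * (q * C₁ + C₂ * q) + N * (q * q)) * 2, by positivity, fun P P' => ?_⟩
  have hf := softmax_isPolicy P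
  have hg := softmax_isPolicy P'
  have h1 := norm_center_sub_le (f := softmax P)
    (h := fun ξ => M.visiting (softmax P) ξ * M.actionValue (softmax P) ξ)
    (k := fun ξ => M.visiting (softmax P') ξ * M.actionValue (softmax P') ξ) hg
  have h2 := M.norm_visiting_mul_sub_le (V := M.actionValue (softmax P))
    (W := M.actionValue (softmax P')) hf hg
  have h3 := M.actionValue_lipschitz hf hg
  have h4 := M.norm_visiting_mul_actionValue_le hf
  have h5 := M.norm_actionValue_le hg
  have h6 := softmax_lipschitz P P'
  have hd0 := norm_nonneg (softmax P - softmax P')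
  rw [← hq] at h2 h3 h4 h5
  refine h1.trans ?_
  set d := ‖softmax P - softmax P'‖
  calc _ ≤ (1 + N) * (q * (C₁ * d) + C₂ * d * q) + N * (q * q) * d := by
        gcongr
        refine h2.trans ?_
        gcongr
    _ = ((1 + N) * (q * C₁ + C₂ * q) + N * (q * q)) * d := by ring
    _ ≤ ((1 + N) * (q * C₁ + C₂ * q) + N * (q * q)) * (2 * ‖P - P'‖) := by gcongr
    _ = _ := by ring

theorem MDP.softmaxGradient_bounded (M : MDP X A) :
    ∃ C : ℝ, 0 ≤ C ∧ ∀ P, ‖M.softmaxGradient P‖ ≤ C := by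
  have := M.nonempty_action
  have hγ := inv_nonneg.2 M.one_sub_γ_pos.le
  refine ⟨(1 + Fintype.card A) * ((1 - M.γ)⁻¹ * (1 - M.γ)⁻¹), by positivity, fun P => ?_⟩
  have hf := softmax_isPolicy P
  have h1 := norm_center_sub_le (f := softmax P)
    (h := fun ξ => M.visiting (softmax P) ξ * M.actionValue (softmax P) ξ) (k := 0) hf
  have h0 : center (softmax P) 0 = 0 := by funext ξ; simp [center]
  rw [h0, sub_zero, sub_zero, sub_self, norm_zero, mul_zero, add_zero] at h1
  exact h1.trans (mul_le_mul_of_nonneg_left (M.norm_visiting_mul_actionValue_le hf) (by positivity))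

theorem MDP.abs_objective_le (M : MDP X A) {f : X × A → ℝ} (hf : IsPolicy f) :
    |M.objective f| ≤ (1 - M.γ)⁻¹ := by
  rw [MDP.objective]
  calc _ ≤ ∑ x, |M.initState x * M.stateValue f x| := Finset.abs_sum_le_sum_abs _ _
    _ ≤ ∑ x, M.initState x * (1 - M.γ)⁻¹ := Finset.sum_le_sum fun x _ => by
        rw [abs_mul, abs_of_nonneg (M.initState_nonneg x)]
        exact mul_le_mul_of_nonneg_left
          ((abs_sum_policy_mul_le hf _ x).trans (M.norm_actionValue_le hf)) (M.initState_nonneg x)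
    _ = _ := by rw [← Finset.sum_mul, M.initState_sum, one_mul]

end PolicyGradient

/-! ### Exploration rate and a comparison lemma -/

section Rates

theorem eta_pos (t : ℝ) : 0 < eta t := by unfold eta; positivity

theorem eta_le_one (t : ℝ) : eta t ≤ 1 := by
  unfold eta
  rw [div_le_one (by positivity)]
  linarith [sq_nonneg (Real.log (t + 1))]

theorem eta_hasDerivAt {t : ℝ} (ht : 0 ≤ t) :
    ∃ e, HasDerivAt eta e t ∧ |e| ≤ eta t / (1 + t) := by
  have ht1 : t + 1 ≠ 0 := by positivity
  have hl : HasDerivAt (fun s : ℝ => Real.log (s + 1)) (1 / (t + 1)) t :=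
    ((hasDerivAt_id t).add_const 1).log ht1
  have hpos : (0 : ℝ) < 1 + Real.log (t + 1) ^ 2 := by positivity
  have hd := (((hl.pow 2).const_add 1).inv hpos.ne')
  refine ⟨_, (hd.congr_of_eventuallyEq (Filter.Eventually.of_forall fun s => ?_)), ?_⟩
  · simp [eta]
  · set l := Real.log (t + 1)
    have h1 : 2 * |l| ≤ 1 + l ^ 2 := by nlinarith [sq_nonneg (|l| - 1), sq_abs l]
    have h2 : |(-((2 : ℕ) * l ^ (2 - 1) * (1 / (t + 1))) / (1 + l ^ 2) ^ 2)| =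
        2 * |l| / ((1 + l ^ 2) ^ 2 * (1 + t)) := by
      rw [abs_div, abs_neg, abs_mul, abs_mul, abs_of_pos (pow_pos hpos 2),
        abs_of_pos (show (0 : ℝ) < 1 / (t + 1) by positivity)]
      simp only [Nat.cast_ofNat, Nat.add_one_sub_one, pow_one, abs_two]
      field_simp
      ring
    refine h2.le.trans ?_
    have h3 : eta t / (1 + t) = (1 + l ^ 2) / ((1 + l ^ 2) ^ 2 * (1 + t)) := by
      rw [eta, show Real.log (t + 1) = l from rfl]; field_simp
    rw [h3]
    gcongr

/-- Powers of the inverse exploration rate grow slower than any positive linear function. -/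
theorem inv_eta_pow_div_tendsto (m : ℕ) :
    Filter.Tendsto (fun t => (eta t ^ m)⁻¹ / (1 + t)) Filter.atTop (𝓝 0) := by
  have h1 : Filter.Tendsto (fun x : ℝ => Real.log x ^ (2 * m) / x) Filter.atTop (𝓝 0) :=
    (Real.isLittleO_pow_log_id_atTop (n := 2 * m)).tendsto_div_nhds_zero
  have h2 : Filter.Tendsto (fun t : ℝ => 2 ^ m * (Real.log (t + 1) ^ (2 * m) / (t + 1)))
      Filter.atTop (𝓝 0) := by
    simpa using (h1.comp (Filter.tendsto_atTop_add_const_right _ 1 Filter.tendsto_id)).const_mul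
      ((2 : ℝ) ^ m)
  refine squeeze_zero' ?_ ?_ h2
  · filter_upwards [Filter.eventually_ge_atTop 0] with t ht
    have := eta_pos t
    positivity
  · filter_upwards [Filter.eventually_ge_atTop (Real.exp 1)] with t ht
    have ht0 : 0 < t := (Real.exp_pos 1).trans_le ht
    have hl : 1 ≤ Real.log (t + 1) := by
      rw [Real.le_log_iff_exp_le (by linarith)]; linarith
    rw [eta, one_div, inv_pow, inv_inv, add_comm 1 t, ← mul_div_assoc, pow_mul, ← mul_pow]
    gcongr
    nlinarith

/-- A quantity with damping of the order of a power of the exploration rate and forcing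
of order `1 / (1 + t)` decays at least as fast as the squared exploration rate. -/
theorem le_eta_sq_of_damped {Y Y' : ℝ → ℝ} {c C : ℝ} (hc : 0 < c) (hC : 0 ≤ C) {n : ℕ}
    (hY : ∀ t, 0 < t → HasDerivAt Y (Y' t) t)
    (hle : ∀ t, 0 < t → Y' t ≤ -c * eta t ^ n * Y t + C / (eta t ^ n * (1 + t) ^ 2)) :
    ∃ K : ℝ, 0 ≤ K ∧ ∀ᶠ t in Filter.atTop, Y t ≤ K * eta t ^ 2 := by
  -- After multiplication by `η^(n+2)` this says that the damping `c η^(n+2)` beats the forcing (the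
  -- `C`) plus the decrease of `η²` (the `2`), all in units of the barrier constant `K`.
  have hev : ∀ᶠ t in Filter.atTop, (C + 2) * ((eta t ^ (2 * n + 2))⁻¹ / (1 + t)) < c := by
    have := (inv_eta_pow_div_tendsto (2 * n + 2)).const_mul (C + 2)
    rw [mul_zero] at this
    exact this.eventually (gt_mem_nhds hc)
  obtain ⟨T, hT⟩ := (hev.and (Filter.eventually_gt_atTop 0)).exists_forall_of_atTop
  have hT0 : 0 < T := (hT T le_rfl).2
  choose! e he hel using fun t (ht : 0 ≤ t) => eta_hasDerivAt ht
  -- The second entry puts `Y` below the barrier at time `T`; the first lets `K` absorb the forcing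
  -- constant.
  set K := max 1 (Y T / eta T ^ 2) with hK
  have hK1 : 1 ≤ K := le_max_left _ _
  have hK0 : 0 ≤ K := zero_le_one.trans hK1
  refine ⟨K, hK0, ?_⟩
  filter_upwards [Filter.eventually_ge_atTop T] with b hb
  have hB : ∀ t, 0 < t → HasDerivAt (fun t => K * eta t ^ 2) (K * (2 * eta t * e t)) t := by
    intro t ht
    have := ((he t ht.le).pow 2).const_mul K
    simpa using this
  -- The strict inequality of derivatives is required only at contact points `Y = K η²`, where the
  -- damping term is known.
  refine image_le_of_deriv_right_lt_deriv_boundary' (f := Y) (f' := Y') (a := T) (b := b)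
    (B := fun t => K * eta t ^ 2) (B' := fun t => K * (2 * eta t * e t))
    (fun t ht => (hY t (hT0.trans_le ht.1)).continuousAt.continuousWithinAt)
    (fun t ht => (hY t (hT0.trans_le ht.1)).hasDerivWithinAt) ?_
    (fun t ht => (hB t (hT0.trans_le ht.1)).continuousAt.continuousWithinAt)
    (fun t ht => (hB t (hT0.trans_le ht.1)).hasDerivWithinAt) ?_ ⟨hb, le_rfl⟩
  · rw [← div_le_iff₀ (pow_pos (eta_pos T) 2)]
    exact le_max_right _ _
  · intro t ht heq
    have ht0 : 0 < t := hT0.trans_le ht.1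
    have hη := eta_pos t
    have hη1 := eta_le_one t
    refine (hle t ht0).trans_lt ?_
    rw [heq]
    have h1 := (hT t ht.1).1
    have hx : (1 : ℝ) ≤ 1 + t := by linarith
    have h2 : -(eta t / (1 + t)) ≤ e t := (abs_le.1 (hel t ht0.le)).1
    have h3 : (C + 2) * ((eta t ^ n)⁻¹ / (1 + t)) < c * eta t ^ (n + 2) := by
      have : (C + 2) * ((eta t ^ n)⁻¹ / (1 + t)) =
          (C + 2) * ((eta t ^ (2 * n + 2))⁻¹ / (1 + t)) * eta t ^ (n + 2) := by
        rw [show 2 * n + 2 = n + (n + 2) by ring, pow_add _ n (n + 2)]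
        field_simp
      rw [this]
      exact mul_lt_mul_of_pos_right h1 (by positivity)
    have h4 : C / (eta t ^ n * (1 + t) ^ 2) ≤ C * ((eta t ^ n)⁻¹ / (1 + t)) := by
      rw [div_eq_mul_inv C, mul_inv]
      refine mul_le_mul_of_nonneg_left ?_ hC
      rw [div_eq_mul_inv]
      refine mul_le_mul_of_nonneg_left ?_ (by positivity)
      exact inv_anti₀ (by positivity) (by nlinarith)
    have h5 : eta t * (eta t / (1 + t)) ≤ (eta t ^ n)⁻¹ / (1 + t) := by
      rw [← mul_div_assoc]
      refine div_le_div_of_nonneg_right ?_ (by positivity)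
      have : 1 ≤ (eta t ^ n)⁻¹ := (one_le_inv₀ (by positivity)).2 (pow_le_one₀ hη.le hη1)
      nlinarith
    have h6 : -(eta t * (eta t / (1 + t))) ≤ eta t * e t := by nlinarith
    have hq : 0 ≤ C * ((eta t ^ n)⁻¹ / (1 + t)) := by positivity
    have h7 : C / (eta t ^ n * (1 + t) ^ 2) ≤ K * (C * ((eta t ^ n)⁻¹ / (1 + t))) :=
      h4.trans (le_mul_of_one_le_left hq hK1)
    calc -c * eta t ^ n * (K * eta t ^ 2) + C / (eta t ^ n * (1 + t) ^ 2)
        ≤ K * (C * ((eta t ^ n)⁻¹ / (1 + t)) - c * eta t ^ (n + 2)) := by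
          rw [pow_add]; nlinarith
      _ < K * (-(2 * ((eta t ^ n)⁻¹ / (1 + t)))) :=
          mul_lt_mul_of_pos_left (by linarith) (by linarith)
      _ ≤ K * (2 * eta t * e t) := mul_le_mul_of_nonneg_left (by nlinarith) hK0

end Rates

/-! ### Quadratic forms in the sup norm -/

section QuadraticForms

open Matrix

variable {S : Type*} [Fintype S]

theorem norm_sq_le_sum_sq (v : S → ℝ) : ‖v‖ ^ 2 ≤ ∑ i, v i ^ 2 := by
  have h : ‖v‖ ≤ √(∑ i, v i ^ 2) := (pi_norm_le_iff_of_nonneg (Real.sqrt_nonneg _)).2 fun i =>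
    Real.abs_le_sqrt (Finset.single_le_sum (f := fun i => v i ^ 2) (fun _ _ => sq_nonneg _)
      (Finset.mem_univ i))
  calc ‖v‖ ^ 2 ≤ √(∑ i, v i ^ 2) ^ 2 := by gcongr
    _ = _ := Real.sq_sqrt (Finset.sum_nonneg fun _ _ => sq_nonneg _)

theorem abs_dotProduct_mulVec_le (B : Matrix S S ℝ) (v w : S → ℝ) :
    |v ⬝ᵥ (B *ᵥ w)| ≤ (∑ i, ∑ j, |B i j|) * (‖v‖ * ‖w‖) := by
  simp only [dotProduct, mulVec, Finset.mul_sum, Finset.sum_mul]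
  refine (Finset.abs_sum_le_sum_abs _ _).trans (Finset.sum_le_sum fun i _ => ?_)
  refine (Finset.abs_sum_le_sum_abs _ _).trans (Finset.sum_le_sum fun j _ => ?_)
  rw [abs_mul, abs_mul]
  have h1 : |v i| ≤ ‖v‖ := norm_le_pi_norm v i
  have h2 : |w j| ≤ ‖w‖ := norm_le_pi_norm w j
  calc |v i| * (|B i j| * |w j|) = |B i j| * (|v i| * |w j|) := by ring
    _ ≤ _ := by gcongr

theorem posDef_lower_bound [Nonempty S] {B : Matrix S S ℝ} (hB : B.PosDef) :
    ∃ a : ℝ, 0 < a ∧ ∀ v : S → ℝ, a * ‖v‖ ^ 2 ≤ v ⬝ᵥ (B *ᵥ v) := by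
  have hcont : Continuous fun v : S → ℝ => v ⬝ᵥ (B *ᵥ v) := by
    simp only [dotProduct, mulVec]; fun_prop
  have hne : (Metric.sphere (0 : S → ℝ) 1).Nonempty := NormedSpace.sphere_nonempty.2 zero_le_one
  obtain ⟨v₀, hv₀, hmin⟩ := (isCompact_sphere (0 : S → ℝ) 1).exists_isMinOn hne hcont.continuousOn
  have hv₀n : ‖v₀‖ = 1 := by simpa using hv₀
  have hv₀' : v₀ ≠ 0 := by rintro rfl; simp at hv₀n
  refine ⟨v₀ ⬝ᵥ (B *ᵥ v₀), by simpa using hB.dotProduct_mulVec_pos hv₀', fun v => ?_⟩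
  rcases eq_or_ne v 0 with rfl | hv
  · simp
  · have hn : ‖v‖ ≠ 0 := norm_ne_zero_iff.2 hv
    have h := hmin (show ‖v‖⁻¹ • v ∈ Metric.sphere (0 : S → ℝ) 1 by
      simp [norm_smul, hn])
    simp only [Set.mem_ofPred_eq, mulVec_smul, dotProduct_smul, smul_dotProduct, smul_eq_mul] at h
    have hp : 0 < ‖v‖ ^ 2 := by positivity
    calc v₀ ⬝ᵥ (B *ᵥ v₀) * ‖v‖ ^ 2
        ≤ (‖v‖⁻¹ * (‖v‖⁻¹ * v ⬝ᵥ (B *ᵥ v))) * ‖v‖ ^ 2 := mul_le_mul_of_nonneg_right h hp.le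
      _ = v ⬝ᵥ (B *ᵥ v) := by field_simp

theorem hasDerivAt_quadratic {B : Matrix S S ℝ} (hB : Bᵀ = B) {φ : ℝ → S → ℝ} {φ' : S → ℝ} {t : ℝ}
    (h : HasDerivAt φ φ' t) :
    HasDerivAt (fun s => φ s ⬝ᵥ (B *ᵥ φ s)) (2 * φ t ⬝ᵥ (B *ᵥ φ')) t := by
  have hi := hasDerivAt_pi.1 h
  have h1 : HasDerivAt (fun s => φ s ⬝ᵥ (B *ᵥ φ s)) (φ' ⬝ᵥ (B *ᵥ φ t) + φ t ⬝ᵥ (B *ᵥ φ')) t := by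
    simp only [dotProduct, mulVec]
    rw [← Finset.sum_add_distrib]
    exact HasDerivAt.fun_sum fun i _ => (hi i).fun_mul
      (HasDerivAt.fun_sum fun j _ => (hi j).const_mul _)
  refine h1.congr_deriv ?_
  rw [dotProduct_comm φ', dotProduct_mulVec (φ t), ← mulVec_transpose, hB]
  ring

end QuadraticForms

/-! ### The exploration policy -/

section Exploration

variable {X A : Type*} [Fintype A]

theorem explore_isPolicy [Nonempty A] (t : ℝ) (P : X × A → ℝ) : IsPolicy (explore t P) where
  nonneg ξ := add_nonneg (div_nonneg (eta_pos t).le (Nat.cast_nonneg _))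
    (mul_nonneg (sub_nonneg.2 (eta_le_one t)) ((softmax_isPolicy P).nonneg ξ))
  sum_eq_one x := by
    have hA : (Fintype.card A : ℝ) ≠ 0 := Nat.cast_ne_zero.2 Fintype.card_ne_zero
    simp only [explore]
    rw [Finset.sum_add_distrib, ← Finset.mul_sum, (softmax_isPolicy P).sum_eq_one]
    simp only [Finset.sum_const, Finset.card_univ, nsmul_eq_mul]
    field_simp
    ring

theorem explore_ge [Nonempty A] (t : ℝ) (P : X × A → ℝ) (ξ : X × A) :
    eta t * (Fintype.card A : ℝ)⁻¹ ≤ explore t P ξ := by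
  rw [explore, div_eq_mul_inv]
  exact le_add_of_nonneg_right
    (mul_nonneg (sub_nonneg.2 (eta_le_one t)) ((softmax_isPolicy P).nonneg ξ))

theorem abs_uniform_sub_le_one [Nonempty A] {f : X × A → ℝ} (hf : IsPolicy f) (ξ : X × A) :
    |(Fintype.card A : ℝ)⁻¹ - f ξ| ≤ 1 := by
  have h1 : (1 : ℝ) ≤ Fintype.card A := Nat.one_le_cast.2 Fintype.card_pos
  have h2 : (Fintype.card A : ℝ)⁻¹ ≤ 1 := inv_le_one_of_one_le₀ h1
  have h3 : 0 ≤ (Fintype.card A : ℝ)⁻¹ := by positivity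
  rw [abs_le]
  constructor <;> linarith [hf.nonneg ξ, hf.le_one ξ]

theorem norm_explore_sub_softmax_le [Fintype X] [Nonempty A] (t : ℝ) (P : X × A → ℝ) :
    ‖explore t P - softmax P‖ ≤ eta t := by
  refine (pi_norm_le_iff_of_nonneg (eta_pos t).le).2 fun ξ => ?_
  have e : (explore t P - softmax P) ξ = eta t * ((Fintype.card A : ℝ)⁻¹ - softmax P ξ) := by
    rw [Pi.sub_apply, explore]; ring
  rw [e, norm_mul, Real.norm_of_nonneg (eta_pos t).le]
  exact mul_le_of_le_one_right (eta_pos t).le (abs_uniform_sub_le_one (softmax_isPolicy P) ξ)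

/-- The two terms are the drift of the exploration rate and that of the logits; both turn out to be
`O(1/(1+t))`. -/
theorem explore_hasDerivAt [Fintype X] [Nonempty A] {P : ℝ → X × A → ℝ} {P' : X × A → ℝ} {t : ℝ}
    (ht : 0 ≤ t) (hP : HasDerivAt P P' t) :
    ∃ g', HasDerivAt (fun s => explore s (P s)) g' t ∧ ‖g'‖ ≤ 1 / (1 + t) + 2 * ‖P'‖ := by
  obtain ⟨e, he, hel⟩ := eta_hasDerivAt ht
  refine ⟨fun ξ => e / Fintype.card A + (-e * softmax (P t) ξ +
    (1 - eta t) * softmaxDeriv (P t) ξ P'), hasDerivAt_pi.2 fun ξ => ?_, ?_⟩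
  · have hs : HasDerivAt (fun s => softmax (P s) ξ) (softmaxDeriv (P t) ξ P') t :=
      (softmax_hasFDerivAt (P t) ξ).comp_hasDerivAt t hP
    exact (he.div_const _).fun_add ((he.const_sub 1).fun_mul hs)
  · refine (pi_norm_le_iff_of_nonneg (by positivity)).2 fun ξ => ?_
    have e1 : e / Fintype.card A + (-e * softmax (P t) ξ +
        (1 - eta t) * softmaxDeriv (P t) ξ P') = e * ((Fintype.card A : ℝ)⁻¹ - softmax (P t) ξ) +
        (1 - eta t) * softmaxDeriv (P t) ξ P' := by ring
    rw [e1, Real.norm_eq_abs]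
    refine (abs_add_le _ _).trans (add_le_add ?_ ?_)
    · rw [abs_mul]
      refine (mul_le_of_le_one_right (abs_nonneg _)
        (abs_uniform_sub_le_one (softmax_isPolicy (P t)) ξ)).trans (hel.trans ?_)
      gcongr
      exact eta_le_one t
    · rw [abs_mul, abs_of_nonneg (sub_nonneg.2 (eta_le_one t))]
      exact (mul_le_of_le_one_left (abs_nonneg _) (by linarith [eta_pos t])).trans
        (abs_softmaxDeriv_le (P t) P' ξ)

end Exploration

/-! ### Differentiating values along a curve of policies -/

section ValueDerivative

open Matrix

variable {X A : Type*} [Fintype X] [Fintype A] [DecidableEq X] [DecidableEq A]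

theorem hasDerivAt_mul_of_vanishing {u h : ℝ → ℝ} {h' x : ℝ} (hu : ContinuousAt u x)
    (hh : HasDerivAt h h' x) (h0 : h x = 0) : HasDerivAt (fun y => u y * h y) (u x * h') x := by
  have := (hasFDerivAt_mul_of_vanishing hu hh.hasFDerivAt h0).hasDerivAt
  simpa using this

/-- The value function is differentiable along a differentiable curve of policies. -/
theorem MDP.actionValue_hasDerivAt (M : MDP X A) {g : ℝ → X × A → ℝ} {g' : X × A → ℝ} {t : ℝ}
    (hg : ∀ s, IsPolicy (g s)) (hd : HasDerivAt g g' t) :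
    ∃ V', HasDerivAt (fun s => M.actionValue (g s)) V' t ∧
      ‖V'‖ ≤ (1 - M.γ)⁻¹ * (Fintype.card (X × A) * (1 - M.γ)⁻¹) * ‖g'‖ := by
  have hγ := inv_nonneg.2 M.one_sub_γ_pos.le
  have hdi := hasDerivAt_pi.1 hd
  have hcont : ContinuousAt (fun s => M.actionValue (g s)) t := by
    rw [ContinuousAt, tendsto_iff_norm_sub_tendsto_zero]
    refine squeeze_zero (fun _ => norm_nonneg _)
      (fun s => M.actionValue_lipschitz (hg s) (hg t)) ?_
    have := (tendsto_iff_norm_sub_tendsto_zero.1 hd.continuousAt.tendsto).const_mul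
      ((1 - M.γ)⁻¹ * (Fintype.card (X × A) * (1 - M.γ)⁻¹))
    simpa using this
  set N : Matrix (X × A) (X × A) ℝ := 1 - M.γ • M.trans (g t) with hN
  have hu : IsUnit N.det := (isUnit_iff_isUnit_det N).1
    (isUnit_one_sub_discounted (M.trans_mem (hg t)) M.γ_pos.le M.γ_lt_one)
  -- Solve the difference of the Bellman equations at `s` and `t` for the values. The unknown still
  -- occurs on the right, but multiplied by `g s - g t`, which vanishes at `t`, so continuity of the
  -- values yields differentiability.
  have hrep : ∀ s, M.actionValue (g s) = M.actionValue (g t) + N⁻¹ *ᵥ fun ξ =>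
      M.γ * ∑ ζ, M.p ξ.1 ξ.2 ζ.1 * (M.actionValue (g s) ζ * (g s ζ - g t ζ)) := by
    intro s
    have e : N *ᵥ (M.actionValue (g s) - M.actionValue (g t)) = fun ξ =>
      M.γ * ∑ ζ, M.p ξ.1 ξ.2 ζ.1 * (M.actionValue (g s) ζ * (g s ζ - g t ζ)) := by
      funext ξ
      rw [hN, sub_mulVec, one_mulVec, smul_mulVec]
      simp only [Pi.sub_apply, Pi.smul_apply, smul_eq_mul, mulVec, dotProduct]
      rw [M.actionValue_eq (hg s), M.actionValue_eq (hg t), add_sub_add_left_eq_sub, ← mul_sub,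
        ← mul_sub, ← Finset.sum_sub_distrib, ← Finset.sum_sub_distrib]
      congr 1
      refine Finset.sum_congr rfl fun ζ _ => ?_
      simp only [MDP.trans, of_apply]
      ring
    rw [← e, mulVec_mulVec, nonsing_inv_mul _ hu, one_mulVec]
    abel
  have hex : ∃ V', HasDerivAt (fun s => M.actionValue (g s)) V' t := by
    refine ⟨fun ξ => ∑ ξ', N⁻¹ ξ ξ' * (M.γ * ∑ ζ, M.p ξ'.1 ξ'.2 ζ.1 *
      (M.actionValue (g t) ζ * g' ζ)), hasDerivAt_pi.2 fun ξ => ?_⟩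
    have : HasDerivAt (fun s => M.actionValue (g t) ξ + ∑ ξ', N⁻¹ ξ ξ' *
        (M.γ * ∑ ζ, M.p ξ'.1 ξ'.2 ζ.1 * (M.actionValue (g s) ζ * (g s ζ - g t ζ))))
        (∑ ξ', N⁻¹ ξ ξ' * (M.γ * ∑ ζ, M.p ξ'.1 ξ'.2 ζ.1 *
          (M.actionValue (g t) ζ * g' ζ))) t := by
      refine (HasDerivAt.fun_sum fun ξ' _ => ((HasDerivAt.fun_sum fun ζ _ =>
        (hasDerivAt_mul_of_vanishing ?_ ((hdi ζ).sub_const _) (sub_self _)).const_mul _).const_mul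
          _).const_mul _).const_add _
      exact continuousAt_pi.1 hcont ζ
    refine this.congr_of_eventuallyEq (Filter.Eventually.of_forall fun s => ?_)
    exact congrFun (hrep s) ξ
  obtain ⟨V', hV'⟩ := hex
  refine ⟨V', hV', ?_⟩
  have hVi := hasDerivAt_pi.1 hV'
  set b : X × A → ℝ := fun ξ => M.γ * ∑ ζ, M.p ξ.1 ξ.2 ζ.1 * (g' ζ * M.actionValue (g t) ζ) with hb
  -- The differentiated Bellman equation is again a discounted equation, whose contraction bound
  -- avoids estimating `N⁻¹`.
  have hfix : ∀ ξ, V' ξ = b ξ + M.γ * ∑ ζ, M.trans (g t) ξ ζ * V' ζ := by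
    intro ξ
    have h1 : HasDerivAt (fun s => M.r ξ + M.γ * ∑ ζ, M.p ξ.1 ξ.2 ζ.1 *
        (g s ζ * M.actionValue (g s) ζ)) (M.γ * ∑ ζ, M.p ξ.1 ξ.2 ζ.1 *
        (g' ζ * M.actionValue (g t) ζ + g t ζ * V' ζ)) t :=
      ((HasDerivAt.fun_sum fun ζ _ => ((hdi ζ).fun_mul (hVi ζ)).const_mul _).const_mul _).const_add _
    have h2 := h1.congr_of_eventuallyEq (f₁ := fun s => M.actionValue (g s) ξ)
      (Filter.Eventually.of_forall fun s => by
        simp only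
        rw [M.actionValue_eq (hg s)]
        simp [MDP.trans, mul_assoc])
    rw [(hVi ξ).unique h2, hb]
    simp only [MDP.trans, of_apply]
    rw [← mul_add, ← Finset.sum_add_distrib]
    congr 1
    exact Finset.sum_congr rfl fun ζ _ => by ring
  have h1 := norm_le_of_discounted_mulVec_eq (M.trans_mem (hg t)) M.γ_pos.le hfix
  have h2 : ‖b‖ ≤ Fintype.card (X × A) * (1 - M.γ)⁻¹ * ‖g'‖ := by
    refine (pi_norm_le_iff_of_nonneg (by positivity)).2 fun ξ => ?_
    rw [hb, Real.norm_eq_abs, abs_mul, abs_of_pos M.γ_pos]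
    refine (mul_le_of_le_one_left (abs_nonneg _) M.γ_lt_one.le).trans ?_
    refine (Finset.abs_sum_le_sum_abs _ _).trans ?_
    rw [mul_assoc, ← nsmul_eq_mul]
    refine Finset.sum_le_card_nsmul _ _ _ fun ζ _ => ?_
    rw [abs_mul, abs_of_nonneg (M.p_nonneg _ _ _), abs_mul, mul_comm (1 - M.γ)⁻¹]
    refine (mul_le_of_le_one_left (by positivity) (M.p_le_one _ _ _)).trans ?_
    exact mul_le_mul (norm_le_pi_norm g' ζ)
      ((norm_le_pi_norm _ ζ).trans (M.norm_actionValue_le (hg t))) (abs_nonneg _) (norm_nonneg _)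
  rw [mul_assoc, ← inv_mul_le_iff₀ (inv_pos.2 M.one_sub_γ_pos), inv_inv]
  exact h1.trans h2

end ValueDerivative

/-! ### Convergence of the critic -/

section Critic

open Matrix

variable {X A : Type*} [Fintype X] [Fintype A]

theorem abs_clip_le (lo hi x : ℝ) : |clip lo hi x| ≤ |lo| + |hi| := by
  unfold clip
  have h1 := neg_abs_le lo
  have h2 := le_abs_self lo
  have h3 := le_abs_self hi
  have h4 := abs_nonneg lo
  have h5 := abs_nonneg hi
  rw [abs_le]
  constructor
  · exact le_trans (by linarith) (le_max_right _ _)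
  · exact max_le ((min_le_right _ _).trans (by linarith)) (by linarith)

theorem abs_clip_sub_le {lo hi y : ℝ} (hy : y ∈ Set.Icc lo hi) (x : ℝ) :
    |clip lo hi x - y| ≤ |x - y| := by
  obtain ⟨h1, h2⟩ := hy
  unfold clip
  rcases le_total x hi with h | h
  · rw [min_eq_left h]
    rcases le_total x lo with h' | h'
    · rw [max_eq_right h', abs_of_nonpos (by linarith), abs_of_nonpos (by linarith)]; linarith
    · rw [max_eq_left h']
  · rw [min_eq_right h, max_eq_left (h1.trans h2), abs_of_nonneg (by linarith),
      abs_of_nonneg (by linarith)]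
    linarith

theorem norm_mulVec_le_sum_abs {S : Type*} [Fintype S] (B : Matrix S S ℝ) (v : S → ℝ) :
    ‖B *ᵥ v‖ ≤ (∑ i, ∑ j, |B i j|) * ‖v‖ := by
  refine (pi_norm_le_iff_of_nonneg (by positivity)).2 fun i => ?_
  rw [mulVec, dotProduct, Real.norm_eq_abs]
  refine (Finset.abs_sum_le_sum_abs _ _).trans ?_
  calc ∑ j, |B i j * v j| ≤ ∑ j, |B i j| * ‖v‖ := Finset.sum_le_sum fun j _ => by
        rw [abs_mul]
        exact mul_le_mul_of_nonneg_left (norm_le_pi_norm v j) (abs_nonneg _)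
    _ = (∑ j, |B i j|) * ‖v‖ := by rw [Finset.sum_mul]
    _ ≤ _ := mul_le_mul_of_nonneg_right (Finset.single_le_sum (f := fun i => ∑ j, |B i j|)
        (fun _ _ => Finset.sum_nonneg fun _ _ => abs_nonneg _) (Finset.mem_univ i)) (norm_nonneg _)

variable [DecidableEq X] [DecidableEq A]

/-- The visiting measure of the exploration policy weighted by the clipped critic. -/
def MDP.clippedWeight (M : MDP X A) (lo hi t : ℝ) (P Q : X × A → ℝ) (ξ : X × A) : ℝ :=
  M.visiting (explore t P) ξ * clip lo hi (Q ξ)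

variable {M : MDP X A} {K : X × A → X × A → ℝ} {α κ lo hi : ℝ} {P Q : ℝ → X × A → ℝ}

theorem IsLimitODESolution.actor_hasDerivAt (h : IsLimitODESolution M K α κ lo hi P Q) {t : ℝ}
    (ht : 0 < t) :
    HasDerivAt P ((zeta t * κ) •
      (of K *ᵥ center (softmax (P t)) (M.clippedWeight lo hi t (P t) (Q t)))) t := by
  refine ((h.actor t ht.le).hasDerivAt (Ici_mem_nhds ht)).congr_deriv ?_
  funext ξ
  simp only [Pi.smul_apply, smul_eq_mul, mulVec, dotProduct, of_apply]
  rw [← sum_mul_sub_policy_average _ _ (K ξ), Finset.mul_sum]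
  exact Finset.sum_congr rfl fun ξ' _ => by rw [MDP.clippedWeight]; ring

/-- Clipping makes the bound independent of `Q`, so the actor is slow before anything is known about
the critic. This breaks the circularity between the two. -/
theorem MDP.exists_actor_bound (M : MDP X A) (K : X × A → X × A → ℝ) (κ lo hi : ℝ) :
    ∃ C : ℝ, 0 ≤ C ∧ ∀ t, 0 < t → ∀ P Q : X × A → ℝ, ‖(zeta t * κ) •
      (of K *ᵥ center (softmax P) (M.clippedWeight lo hi t P Q))‖ ≤ C / (1 + t) := by
  have := M.nonempty_action
  have hγ := inv_nonneg.2 M.one_sub_γ_pos.le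
  set k := ∑ i, ∑ j, |of K i j| with hk
  have hk0 : 0 ≤ k := Finset.sum_nonneg fun _ _ => Finset.sum_nonneg fun _ _ => abs_nonneg _
  refine ⟨|κ| * (k * ((1 + Fintype.card A) * ((1 - M.γ)⁻¹ * (|lo| + |hi|)))), by positivity,
    fun t ht P Q => ?_⟩
  have hw : ‖M.clippedWeight lo hi t P Q‖ ≤ (1 - M.γ)⁻¹ * (|lo| + |hi|) := by
    refine (pi_norm_le_iff_of_nonneg (by positivity)).2 fun ξ => ?_
    rw [MDP.clippedWeight, norm_mul]
    exact mul_le_mul (M.abs_visiting_le (explore_isPolicy t P) ξ) (abs_clip_le _ _ _)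
      (norm_nonneg _) hγ
  have hcen := norm_center_sub_le (f := softmax P) (g := softmax P)
    (h := M.clippedWeight lo hi t P Q) (k := 0) (softmax_isPolicy P)
  have h0 : center (softmax P) 0 = 0 := by funext ξ; simp [center]
  rw [h0, sub_zero, sub_zero, sub_self, norm_zero, mul_zero, add_zero] at hcen
  rw [norm_smul, Real.norm_eq_abs, abs_mul, zeta, abs_of_pos (by positivity : 0 < 1 / (1 + t))]
  calc 1 / (1 + t) * |κ| * _ ≤ 1 / (1 + t) * |κ| *
        (k * ((1 + Fintype.card A) * ((1 - M.γ)⁻¹ * (|lo| + |hi|)))) := by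
        gcongr
        refine (norm_mulVec_le_sum_abs _ _).trans ?_
        rw [← hk]
        gcongr
        refine hcen.trans ?_
        gcongr
    _ = _ := by ring

/-- `V^g` has zero residual, so the temporal-difference error is linear in the tracking error, the
form required by `stationary_dissipative`. -/
theorem MDP.bellman_residual (M : MDP X A) {g : X × A → ℝ} (hg : IsPolicy g) (q : X × A → ℝ)
    (ξ : X × A) :
    M.r ξ + M.γ * (∑ z : X, ∑ a : A, q (z, a) * g (z, a) * M.p ξ.1 ξ.2 z) - q ξ =
      M.γ * ∑ ζ, M.trans g ξ ζ * (q - M.actionValue g) ζ - (q - M.actionValue g) ξ := by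
  have h := M.actionValue_eq hg ξ
  have e : ∑ z : X, ∑ a : A, q (z, a) * g (z, a) * M.p ξ.1 ξ.2 z = ∑ ζ, M.trans g ξ ζ * q ζ := by
    rw [Fintype.sum_prod_type]
    refine Finset.sum_congr rfl fun z _ => Finset.sum_congr rfl fun a _ => ?_
    simp only [MDP.trans, of_apply]; ring
  simp only [Pi.sub_apply, mul_sub, Finset.sum_sub_distrib]
  rw [e]
  linarith

/-- The stationary law of the exploration policy is bounded below by a power of the exploration
rate. -/
theorem MDP.IsErgodic.stationary_explore_ge (hM : M.IsErgodic) :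
    ∃ c : ℝ, 0 < c ∧ ∃ n : ℕ, ∀ t P π, IsStationary (M.trans (explore t P)) π →
      ∀ ξ, c * eta t ^ n ≤ π ξ := by
  have := M.nonempty_action
  have := M.nonempty
  have hA : (0 : ℝ) < Fintype.card A := Nat.cast_pos.2 Fintype.card_pos
  -- The uniform policy is the reference: `explore` dominates `η` times it, whatever the logits.
  set u : X × A → ℝ := fun _ => (Fintype.card A : ℝ)⁻¹ with hu
  have hup : IsPolicy u := ⟨fun _ => (inv_pos.2 hA).le, fun x => by simp [hu, hA.ne']⟩
  obtain ⟨c, hc, n, hn⟩ := stationary_lower_bound (U := M.trans u)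
    (fun ξ ξ' => mul_nonneg (M.p_nonneg _ _ _) (hup.nonneg ξ'))
    (hM u hup fun _ => inv_pos.2 hA).1.1
  refine ⟨c, hc, n, fun t P π hπ ξ => hn (eta t) (eta_pos t) (eta_le_one t) _ (fun ζ ζ' => ?_) π hπ ξ⟩
  simp only [MDP.trans, of_apply]
  calc eta t * (M.p ζ.1 ζ.2 ζ'.1 * u ζ') = M.p ζ.1 ζ.2 ζ'.1 * (eta t * (Fintype.card A : ℝ)⁻¹) := by
        rw [hu]; ring
    _ ≤ _ := mul_le_mul_of_nonneg_left (explore_ge t P ζ') (M.p_nonneg _ _ _)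

/-- The critic tracks the value function of the exploration policy. -/
theorem IsLimitODESolution.critic_tracks_explore (hM : M.IsErgodic) (hK : (of K).PosDef)
    (hα : 0 < α) (h : IsLimitODESolution M K α κ lo hi P Q) :
    ∃ C : ℝ, 0 ≤ C ∧ ∀ᶠ t in Filter.atTop,
      ‖Q t - M.actionValue (explore t (P t))‖ ≤ C * eta t := by
  have := M.nonempty_action
  have := M.nonempty
  have hγ := M.one_sub_γ_pos
  obtain ⟨c₀, hc₀, n, hstat⟩ := hM.stationary_explore_ge
  obtain ⟨CP, hCP, hPb⟩ := M.exists_actor_bound K κ lo hi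
  -- Measuring the error with the inverse kernel cancels the kernel in the critic equation; the bare
  -- product of kernel and Bellman operator need not be dissipative.
  set B := (of K)⁻¹ with hB
  have hBpos : B.PosDef := hK.inv
  have hBsymm : Bᵀ = B := isHermitian_iff_isSymm.1 hBpos.isHermitian
  have hBK : ∀ w, B *ᵥ (of K *ᵥ w) = w := fun w => by
    rw [mulVec_mulVec, hB, nonsing_inv_mul _ ((isUnit_iff_isUnit_det _).1 hK.isUnit), one_mulVec]
  obtain ⟨a, ha, hlow⟩ := posDef_lower_bound hBpos
  set b := ∑ i, ∑ j, |B i j| with hb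
  have hb0 : 0 ≤ b := Finset.sum_nonneg fun _ _ => Finset.sum_nonneg fun _ _ => abs_nonneg _
  set CV := (1 - M.γ)⁻¹ * (Fintype.card (X × A) * (1 - M.γ)⁻¹) with hCV
  have hCV0 : 0 ≤ CV := by have := inv_nonneg.2 hγ.le; positivity
  set D := CV * (1 + 2 * CP) with hD
  have hD0 : 0 ≤ D := by positivity
  set φ : ℝ → X × A → ℝ := fun t => Q t - M.actionValue (explore t (P t)) with hφ
  set k := α * (1 - M.γ) * c₀ with hk
  have hk0 : 0 < k := by positivity
  have key : ∀ t, 0 < t → ∃ y', HasDerivAt (fun s => φ s ⬝ᵥ (B *ᵥ φ s)) y' t ∧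
      y' ≤ -(k / (b + 1)) * eta t ^ n * (φ t ⬝ᵥ (B *ᵥ φ t)) +
        (b ^ 2 * D ^ 2 / k) / (eta t ^ n * (1 + t) ^ 2) := by
    intro t ht
    obtain ⟨π, hπ, hQ⟩ := h.critic t ht.le
    replace hQ := hQ.hasDerivAt (Ici_mem_nhds ht)
    have hpol := explore_isPolicy t (P t)
    obtain ⟨g', hg', hg'b⟩ := explore_hasDerivAt ht.le (h.actor_hasDerivAt ht)
    obtain ⟨V', hV', hV'b⟩ := M.actionValue_hasDerivAt (fun s => explore_isPolicy s (P s)) hg'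
    set w : X × A → ℝ := fun ξ =>
      (M.γ * ∑ ζ, M.trans (explore t (P t)) ξ ζ * φ t ζ - φ t ξ) * π ξ with hw
    have hQ2 : HasDerivAt Q (α • (of K *ᵥ w)) t := by
      refine hQ.congr_deriv ?_
      funext ξ
      simp only [Pi.smul_apply, smul_eq_mul, mulVec, dotProduct, of_apply]
      congr 1
      refine Finset.sum_congr rfl fun ξ' _ => ?_
      rw [M.bellman_residual hpol, hw, mul_assoc]
    have hφd : HasDerivAt φ (α • (of K *ᵥ w) - V') t := hQ2.sub hV'
    refine ⟨_, hasDerivAt_quadratic hBsymm hφd, ?_⟩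
    have e1 : φ t ⬝ᵥ (B *ᵥ (α • (of K *ᵥ w) - V')) = α * (φ t ⬝ᵥ w) - φ t ⬝ᵥ (B *ᵥ V') := by
      rw [mulVec_sub, mulVec_smul, hBK, dotProduct_sub, dotProduct_smul, smul_eq_mul]
    have hη := pow_pos (eta_pos t) n
    have h1 : φ t ⬝ᵥ w ≤ -(1 - M.γ) * (c₀ * eta t ^ n * ‖φ t‖ ^ 2) := by
      refine (stationary_dissipative hπ (M.trans_mem hpol) M.γ_pos.le (φ t)).trans ?_
      rw [neg_mul, neg_mul, neg_le_neg_iff]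
      refine mul_le_mul_of_nonneg_left ?_ hγ.le
      calc c₀ * eta t ^ n * ‖φ t‖ ^ 2 ≤ c₀ * eta t ^ n * ∑ ξ, φ t ξ ^ 2 := by
            gcongr; exact norm_sq_le_sum_sq _
        _ = ∑ ξ, c₀ * eta t ^ n * φ t ξ ^ 2 := Finset.mul_sum _ _ _
        _ ≤ ∑ ξ, π ξ * φ t ξ ^ 2 := Finset.sum_le_sum fun ξ _ =>
            mul_le_mul_of_nonneg_right (hstat t (P t) π hπ ξ) (sq_nonneg _)
    have hV'D : ‖V'‖ ≤ D / (1 + t) := by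
      refine hV'b.trans ?_
      rw [hD, mul_div_assoc]
      refine mul_le_mul_of_nonneg_left (hg'b.trans ?_) hCV0
      have := hPb t ht (P t) (Q t)
      rw [add_div, mul_div_assoc]
      linarith
    have h2 : -(φ t ⬝ᵥ (B *ᵥ V')) ≤ b * (‖φ t‖ * (D / (1 + t))) := by
      refine (neg_le_abs _).trans ((abs_dotProduct_mulVec_le B (φ t) V').trans ?_)
      gcongr
    have h3 : φ t ⬝ᵥ (B *ᵥ φ t) ≤ (b + 1) * ‖φ t‖ ^ 2 := by
      refine (le_abs_self _).trans ((abs_dotProduct_mulVec_le B (φ t) (φ t)).trans ?_)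
      rw [← hb]
      nlinarith [sq_nonneg ‖φ t‖]
    -- The shift `b + 1` keeps the denominator positive without a lower bound on `b`.
    have h4 : k / (b + 1) * eta t ^ n * (φ t ⬝ᵥ (B *ᵥ φ t)) ≤ k * eta t ^ n * ‖φ t‖ ^ 2 := by
      have := mul_le_mul_of_nonneg_left h3 (show 0 ≤ k / (b + 1) * eta t ^ n by positivity)
      refine this.trans (le_of_eq ?_)
      field_simp
    -- Young's inequality: half of the damping `2 k η^n ‖φ‖²` absorbs the cross term, and the other
    -- half survives for the comparison lemma.
    have h5 : 2 * (b * (‖φ t‖ * (D / (1 + t)))) ≤ k * eta t ^ n * ‖φ t‖ ^ 2 +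
        (b ^ 2 * D ^ 2 / k) / (eta t ^ n * (1 + t) ^ 2) := by
      have hp : 0 < k * eta t ^ n := by positivity
      have e2 : (b ^ 2 * D ^ 2 / k) / (eta t ^ n * (1 + t) ^ 2) =
          (b * (D / (1 + t))) ^ 2 / (k * eta t ^ n) := by field_simp
      have e3 : k * eta t ^ n * ‖φ t‖ ^ 2 + (b * (D / (1 + t))) ^ 2 / (k * eta t ^ n) -
          2 * (b * (‖φ t‖ * (D / (1 + t)))) =
          (k * eta t ^ n * ‖φ t‖ - b * (D / (1 + t))) ^ 2 / (k * eta t ^ n) := by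
        field_simp
        ring
      have := div_nonneg (sq_nonneg (k * eta t ^ n * ‖φ t‖ - b * (D / (1 + t)))) hp.le
      rw [e2]
      linarith
    rw [e1]
    have h6 := mul_le_mul_of_nonneg_left h1 hα.le
    have h7 : α * (-(1 - M.γ) * (c₀ * eta t ^ n * ‖φ t‖ ^ 2)) = -(k * eta t ^ n * ‖φ t‖ ^ 2) := by
      rw [hk]; ring
    linarith
  choose! Y' hY hYle using key
  obtain ⟨C, hC, hev⟩ := le_eta_sq_of_damped (by positivity : 0 < k / (b + 1))
    (by positivity : 0 ≤ b ^ 2 * D ^ 2 / k) hY hYle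
  refine ⟨√(C / a), Real.sqrt_nonneg _, ?_⟩
  filter_upwards [hev] with t ht
  have h1 : ‖φ t‖ ^ 2 ≤ C / a * eta t ^ 2 := by
    rw [div_mul_eq_mul_div, le_div_iff₀' ha]
    exact (hlow _).trans ht
  have h2 := Real.abs_le_sqrt h1
  rwa [abs_of_nonneg (norm_nonneg _), Real.sqrt_mul (by positivity),
    Real.sqrt_sq (eta_pos t).le] at h2

/-- The critic tracks the value function of the actor. -/
theorem IsLimitODESolution.critic_tracks (hM : M.IsErgodic) (hK : (of K).PosDef)
    (hα : 0 < α) (h : IsLimitODESolution M K α κ lo hi P Q) :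
    ∃ C : ℝ, 0 ≤ C ∧ ∀ᶠ t in Filter.atTop,
      ‖Q t - M.actionValue (softmax (P t))‖ ≤ C * eta t := by
  have := M.nonempty_action
  obtain ⟨C, hC, hev⟩ := h.critic_tracks_explore hM hK hα
  set CV := (1 - M.γ)⁻¹ * (Fintype.card (X × A) * (1 - M.γ)⁻¹) with hCV
  have hCV0 : 0 ≤ CV := by have := inv_nonneg.2 M.one_sub_γ_pos.le; positivity
  refine ⟨C + CV, by positivity, ?_⟩
  filter_upwards [hev] with t ht
  have h1 := M.actionValue_lipschitz (explore_isPolicy t (P t)) (softmax_isPolicy (P t))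
  have h2 := mul_le_mul_of_nonneg_left (norm_explore_sub_softmax_le t (P t)) hCV0
  have h3 := norm_sub_le_norm_sub_add_norm_sub (Q t) (M.actionValue (explore t (P t)))
    (M.actionValue (softmax (P t)))
  rw [add_mul]
  linarith

end Critic

/-! ### Convergence of the actor -/

section Actor

open Matrix Filter

/-- A Lipschitz function that is dominated by the derivative of a bounded function tends to zero. -/
theorem tendsto_zero_of_lipschitz_of_le_deriv {Φ Φ' G : ℝ → ℝ} {c L m u₀ : ℝ} (hc : 0 < c)
    (hL : 0 ≤ L) (hG : ∀ u, 0 ≤ G u) (hd : ∀ u, u₀ ≤ u → HasDerivAt Φ (Φ' u) u)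
    (hle : ∀ u, u₀ ≤ u → c * G u ≤ Φ' u) (hbd : ∀ u, u₀ ≤ u → Φ u ≤ m)
    (hlip : ∀ u v, u₀ ≤ u → u₀ ≤ v → |G u - G v| ≤ L * |u - v|) : Tendsto G atTop (𝓝 0) := by
  have hmono : MonotoneOn Φ (Set.Ici u₀) := by
    refine monotoneOn_of_deriv_nonneg (convex_Ici u₀)
      (fun u hu => (hd u hu).continuousAt.continuousWithinAt)
      (fun u hu => (hd u (interior_subset hu)).differentiableAt.differentiableWithinAt)
      fun u hu => ?_
    rw [(hd u (interior_subset hu)).deriv]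
    exact (mul_nonneg hc.le (hG u)).trans (hle u (interior_subset hu))
  have hmono' : Monotone fun u => Φ (max u u₀) := fun u v huv =>
    hmono (Set.mem_Ici.2 (le_max_right u u₀)) (Set.mem_Ici.2 (le_max_right v u₀))
      (max_le_max_right _ huv)
  have hlim : ∃ l, Tendsto (fun u => Φ (max u u₀)) atTop (𝓝 l) :=
    ⟨_, tendsto_atTop_ciSup hmono' ⟨m, by rintro _ ⟨u, rfl⟩; exact hbd _ (le_max_right _ _)⟩⟩
  obtain ⟨l, hl⟩ := hlim
  have hlim' : Tendsto Φ atTop (𝓝 l) := hl.congr' (by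
    filter_upwards [eventually_ge_atTop u₀] with u hu
    rw [max_eq_left hu])
  rw [Metric.tendsto_atTop']
  intro ε hε
  -- Over a time `δ` the function `G` varies by at most `ε/2`; `L + 1` covers `L = 0`.
  set δ := ε / (2 * (L + 1)) with hδ
  have hδ0 : 0 < δ := by positivity
  have hLδ : L * δ ≤ ε / 2 := by
    rw [hδ, ← mul_div_assoc, div_le_div_iff₀ (by positivity) (by positivity)]
    nlinarith
  have hdiff : Tendsto (fun u => Φ (u + δ) - Φ u) atTop (𝓝 0) := by
    have := (hlim'.comp (tendsto_atTop_add_const_right _ δ tendsto_id)).sub hlim'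
    simpa using this
  have hev := (hdiff.eventually (gt_mem_nhds (show 0 < c * δ * (ε / 2) by positivity))).and
    (eventually_ge_atTop u₀)
  obtain ⟨N, hN⟩ := hev.exists_forall_of_atTop
  refine ⟨N, fun u hu => ?_⟩
  obtain ⟨h1, hu0⟩ := hN u hu.le
  -- The mean value theorem finds a point within `δ` of `u` where `Φ'`, hence `G`, is small; the
  -- Lipschitz bound carries this back to `u`.
  obtain ⟨v, hv, hv'⟩ := exists_hasDerivAt_eq_slope Φ Φ' (show u < u + δ by linarith)
    (fun s hs => (hd s (hu0.trans hs.1)).continuousAt.continuousWithinAt)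
    (fun s hs => hd s (hu0.trans hs.1.le))
  have hv0 : u₀ ≤ v := hu0.trans hv.1.le
  have h2 := hle v hv0
  rw [hv', add_sub_cancel_left, le_div_iff₀ hδ0] at h2
  have h3 : G v < ε / 2 := by
    have : c * δ * G v < c * δ * (ε / 2) := by nlinarith
    exact lt_of_mul_lt_mul_left this (by positivity)
  have h4 := hlip u v hu0 hv0
  have h5 : |u - v| ≤ δ := by
    rw [abs_of_nonpos (by linarith [hv.1])]; linarith [hv.2]
  have h6 : G u - G v ≤ ε / 2 := (le_abs_self _).trans
    (h4.trans ((mul_le_mul_of_nonneg_left h5 hL).trans hLδ))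
  rw [Real.dist_eq, sub_zero, abs_of_nonneg (hG u)]
  linarith

variable {X A : Type*} [Fintype X] [Fintype A] [DecidableEq X] [DecidableEq A]
variable {M : MDP X A} {K : X × A → X × A → ℝ} {α κ lo hi : ℝ} {P Q : ℝ → X × A → ℝ}

/-- Up to an error of the order of the exploration rate, the actor follows the policy gradient. -/
theorem IsLimitODESolution.actor_direction (hM : M.IsErgodic) (hK : (of K).PosDef) (hα : 0 < α)
    (hwin : ∀ f : X × A → ℝ, IsPolicy f → ∀ ξ, M.actionValue f ξ ∈ Set.Icc lo hi)
    (h : IsLimitODESolution M K α κ lo hi P Q) :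
    ∃ C : ℝ, 0 ≤ C ∧ ∀ᶠ t in atTop,
      ‖center (softmax (P t)) (M.clippedWeight lo hi t (P t) (Q t)) - M.softmaxGradient (P t)‖ ≤
        C * eta t := by
  have := M.nonempty_action
  obtain ⟨C, hC, hev⟩ := h.critic_tracks hM hK hα
  have hγ := inv_nonneg.2 M.one_sub_γ_pos.le
  set q := (1 - M.γ)⁻¹ with hq
  set C₂ := q * (Fintype.card (X × A) * (1 + q)) with hC₂
  have hC₂0 : 0 ≤ C₂ := by positivity
  refine ⟨(1 + Fintype.card A) * (q * C + C₂ * q), by positivity, ?_⟩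
  filter_upwards [hev] with t ht
  have hf := softmax_isPolicy (P t)
  have hg := explore_isPolicy t (P t)
  have hη := (eta_pos t).le
  have h1 := norm_center_sub_le (f := softmax (P t)) (h := M.clippedWeight lo hi t (P t) (Q t))
    (k := fun ξ => M.visiting (softmax (P t)) ξ * M.actionValue (softmax (P t)) ξ) hf
  rw [sub_self (softmax (P t)), norm_zero, mul_zero, add_zero] at h1
  have h2 := M.norm_visiting_mul_sub_le (V := fun ξ => clip lo hi (Q t ξ))
    (W := M.actionValue (softmax (P t))) hg hf
  have h3 : ‖(fun ξ => clip lo hi (Q t ξ)) - M.actionValue (softmax (P t))‖ ≤ C * eta t := by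
    refine (pi_norm_le_iff_of_nonneg (by positivity)).2 fun ξ => ?_
    exact (abs_clip_sub_le (hwin _ hf ξ) (Q t ξ)).trans ((norm_le_pi_norm
      (Q t - M.actionValue (softmax (P t))) ξ).trans ht)
  refine h1.trans ?_
  rw [mul_assoc]
  refine mul_le_mul_of_nonneg_left (h2.trans ?_) (by positivity)
  calc _ ≤ q * (C * eta t) + C₂ * eta t * q := by
        gcongr
        · exact norm_explore_sub_softmax_le t (P t)
        · exact M.norm_actionValue_le hf
    _ = _ := by ring

theorem IsLimitODESolution.gradient_tendsto_zero (hM : M.IsErgodic) (hK : (of K).PosDef)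
    (hα : 0 < α) (hκ : 0 < κ)
    (hwin : ∀ f : X × A → ℝ, IsPolicy f → ∀ ξ, M.actionValue f ξ ∈ Set.Icc lo hi)
    (h : IsLimitODESolution M K α κ lo hi P Q) :
    Tendsto (fun t => M.softmaxGradient (P t)) atTop (𝓝 0) := by
  have := M.nonempty_action
  have := M.nonempty
  obtain ⟨CE, hCE, hevE⟩ := h.actor_direction hM hK hα hwin
  obtain ⟨CP, hCP, hPb⟩ := M.exists_actor_bound K κ lo hi
  obtain ⟨LG, hLG, hlipG⟩ := M.softmaxGradient_lipschitz
  obtain ⟨CG, hCG, hGb⟩ := M.softmaxGradient_bounded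
  obtain ⟨a, ha, hlow⟩ := posDef_lower_bound hK
  set b := ∑ i, ∑ j, |of K i j| with hb
  have hb0 : 0 ≤ b := Finset.sum_nonneg fun _ _ => Finset.sum_nonneg fun _ _ => abs_nonneg _
  obtain ⟨T, hT⟩ := hevE.exists_forall_of_atTop
  -- Logarithmic time: `τ' = 1 + τ` cancels the learning rate `ζ`, and `η ∘ τ` is `1/(1+u²)`.
  set τ : ℝ → ℝ := fun u => Real.exp u - 1 with hτ
  have hτ1 : ∀ u, 1 + τ u = Real.exp u := fun u => by rw [hτ]; ring
  have hτpos : ∀ u, 0 < u → 0 < τ u := fun u hu => sub_pos.2 (Real.one_lt_exp_iff.2 hu)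
  -- The `1` keeps `τ u` inside the open half-line, where derivatives are two-sided; the `T`
  -- suffices because `τ u ≥ u`.
  set u₀ := max 1 T with hu₀
  have hu₀1 : ∀ u, u₀ ≤ u → 0 < u := fun u hu => zero_lt_one.trans_le ((le_max_left _ _).trans hu)
  have hτT : ∀ u, u₀ ≤ u → T ≤ τ u := fun u hu => by
    have h1 : T ≤ u := (le_max_right _ _).trans hu
    have h2 := Real.add_one_le_exp u
    simp only [hτ]
    linarith
  have hητ : ∀ u, eta (τ u) = 1 / (1 + u ^ 2) := fun u => by
    rw [eta, add_comm (τ u), hτ1, Real.log_exp]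
  set W : ℝ → X × A → ℝ := fun u =>
    center (softmax (P (τ u))) (M.clippedWeight lo hi (τ u) (P (τ u)) (Q (τ u))) with hW
  set p : ℝ → X × A → ℝ := fun u => P (τ u) with hp
  set p' : ℝ → X × A → ℝ := fun u => κ • (of K *ᵥ W u) with hp'
  have hpd : ∀ u, 0 < u → HasDerivAt p (p' u) u := by
    intro u hu
    have h1 : HasDerivAt τ (Real.exp u) u := (Real.hasDerivAt_exp u).sub_const 1
    have h2 := (h.actor_hasDerivAt (hτpos u hu)).scomp u h1
    refine h2.congr_deriv ?_
    rw [smul_smul, zeta, hτ1, hp', hW]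
    congr 1
    rw [← mul_assoc, mul_one_div_cancel (Real.exp_pos u).ne', one_mul]
  have hp'b : ∀ u, 0 < u → ‖p' u‖ ≤ CP := by
    intro u hu
    have h1 := hPb (τ u) (hτpos u hu) (P (τ u)) (Q (τ u))
    rw [zeta, hτ1, ← smul_smul, norm_smul, Real.norm_of_nonneg (by positivity), one_div,
      div_eq_inv_mul] at h1
    exact le_of_mul_le_mul_left h1 (by positivity)
  have hplip : ∀ u v, u₀ ≤ u → u₀ ≤ v → ‖p u - p v‖ ≤ CP * |u - v| := by
    intro u v hu hv
    exact (convex_Ici u₀).norm_image_sub_le_of_norm_hasDerivWithin_le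
      (fun s hs => (hpd s (hu₀1 s hs)).hasDerivWithinAt) (fun s hs => hp'b s (hu₀1 s hs)) hv hu
  set C := b * (CG * CE) with hCdef
  have hC0 : 0 ≤ C := by positivity
  -- The arctangent is a bounded primitive of the error `1/(1+u²)`; adding it makes the objective
  -- monotone along the path while keeping it bounded above.
  set Φ : ℝ → ℝ := fun u => M.objective (softmax (p u)) + κ * C * Real.arctan u with hΦ
  have hΦd : ∀ u, u₀ ≤ u → HasDerivAt Φ
      (κ * (M.softmaxGradient (p u) ⬝ᵥ (of K *ᵥ W u)) + κ * C * (1 / (1 + u ^ 2))) u := by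
    intro u hu
    obtain ⟨L, hL, hLd⟩ := M.objective_hasFDerivAt (p u)
    have h1 := hLd.comp_hasDerivAt u (hpd u (hu₀1 u hu))
    refine (h1.fun_add ((Real.hasDerivAt_arctan u).const_mul (κ * C))).congr_deriv ?_
    rw [hL, hp']
    simp only [Pi.smul_apply, smul_eq_mul, dotProduct, Finset.mul_sum]
    congr 1
    exact Finset.sum_congr rfl fun ξ _ => by ring
  have hlim : Tendsto (fun u => ‖M.softmaxGradient (p u)‖ ^ 2) atTop (𝓝 0) := by
    refine tendsto_zero_of_lipschitz_of_le_deriv (c := κ * a) (L := 2 * CG * (LG * CP))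
      (m := (1 - M.γ)⁻¹ + κ * C * (Real.pi / 2)) (u₀ := u₀) (by positivity) (by positivity)
      (fun u => by positivity) hΦd ?_ ?_ ?_
    · intro u hu
      set G := M.softmaxGradient (p u) with hG
      have e : G ⬝ᵥ (of K *ᵥ W u) = G ⬝ᵥ (of K *ᵥ G) + G ⬝ᵥ (of K *ᵥ (W u - G)) := by
        rw [mulVec_sub, dotProduct_sub]; ring
      have h1 : ‖W u - G‖ ≤ CE * (1 / (1 + u ^ 2)) := by
        rw [← hητ]; exact hT (τ u) (hτT u hu)
      have h2 : -(C * (1 / (1 + u ^ 2))) ≤ G ⬝ᵥ (of K *ᵥ (W u - G)) := by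
        refine le_trans ?_ (neg_abs_le _)
        rw [neg_le_neg_iff]
        refine (abs_dotProduct_mulVec_le _ _ _).trans ?_
        calc b * (‖G‖ * ‖W u - G‖) ≤ b * (CG * (CE * (1 / (1 + u ^ 2)))) := by
              gcongr
              exact hGb _
          _ = _ := by rw [hCdef]; ring
      have h3 := hlow G
      rw [e]
      calc κ * a * ‖G‖ ^ 2 = κ * (a * ‖G‖ ^ 2 - C * (1 / (1 + u ^ 2)) + C * (1 / (1 + u ^ 2))) := by
            ring
        _ ≤ κ * (G ⬝ᵥ (of K *ᵥ G) + G ⬝ᵥ (of K *ᵥ (W u - G)) + C * (1 / (1 + u ^ 2))) :=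
            mul_le_mul_of_nonneg_left (by linarith) hκ.le
        _ = _ := by ring
    · intro u _
      refine add_le_add ((le_abs_self _).trans (M.abs_objective_le (softmax_isPolicy _))) ?_
      exact mul_le_mul_of_nonneg_left (Real.arctan_lt_pi_div_two u).le (by positivity)
    · intro u v hu hv
      have h1 := (hlipG (p u) (p v)).trans (mul_le_mul_of_nonneg_left (hplip u v hu hv) hLG)
      have h2 := hGb (p u)
      have h3 := hGb (p v)
      have h4 := (abs_norm_sub_norm_le (M.softmaxGradient (p u)) (M.softmaxGradient (p v))).trans h1
      rw [sq_sub_sq, abs_mul, abs_of_nonneg (by positivity), mul_assoc (2 * CG), mul_assoc LG]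
      exact mul_le_mul (by linarith) h4 (abs_nonneg _) (by positivity)
  have hnorm : Tendsto (fun u => ‖M.softmaxGradient (p u)‖) atTop (𝓝 0) := by
    have := (Real.continuous_sqrt.tendsto 0).comp hlim
    simpa [Function.comp_def, Real.sqrt_sq (norm_nonneg _)] using this
  have hlog : Tendsto (fun t : ℝ => Real.log (1 + t)) atTop atTop :=
    Real.tendsto_log_atTop.comp (tendsto_atTop_add_const_left _ 1 tendsto_id)
  refine tendsto_zero_iff_norm_tendsto_zero.2 ((hnorm.comp hlog).congr' ?_)
  filter_upwards [eventually_gt_atTop 0] with t ht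
  have e : τ (Real.log (1 + t)) = t := by
    rw [hτ]
    simp only
    rw [Real.exp_log (by linarith)]
    ring
  simp only [Function.comp_apply, hp, e]

end Actor

end ActorCritic

end

theorem theorem2 {X A : Type*} [Fintype X] [Fintype A] [DecidableEq X] [DecidableEq A]
    {dx da : ℕ}
    -- the finite MDP and its ergodicity
    (M : ActorCritic.MDP X A) (hM : M.IsErgodic)
    -- states and actions are distinct points of Euclidean spaces; one state coordinate is the bias
    (eX : X → EuclideanSpace ℝ (Fin dx)) (eA : A → EuclideanSpace ℝ (Fin da))
    (heX : Function.Injective eX) (heA : Function.Injective eA)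
    (hbias : ∃ i : Fin dx, ∀ x, eX x i = 1)
    -- activation function
    (act : ℝ → ℝ) (hact : ActorCritic.IsActivation act) (hconst : ∃ x y, act x ≠ act y)
    -- law of the initial network parameters `(c, w)`
    (ν₀ : MeasureTheory.Measure (ℝ × ActorCritic.Feat dx da)) [MeasureTheory.IsProbabilityMeasure ν₀]
    (hac : MeasureTheory.Measure.AbsolutelyContinuous ν₀ MeasureTheory.volume)
    (hc : ∀ᵐ z ∂ν₀, |z.1| ≤ 1)
    (hw : AnalyticOnNhd ℝ act Set.univ ∨
      ∀ U : Set (ActorCritic.Feat dx da), IsOpen U → U.Nonempty → 0 < ν₀ (Prod.snd ⁻¹' U))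
    -- a solution of the limit ODE, from an arbitrary starting point
    (α : ℝ) (hα : 0 < α) (κ : ℝ) (hκ : κ = 1 ∨ κ = 1 - M.γ) (lo hi : ℝ)
    (P Q : ℝ → X × A → ℝ)
    (hODE : ActorCritic.IsLimitODESolution M (ActorCritic.kernel eX eA act ν₀) α κ lo hi P Q) :
    -- the critic tracks the value function of the current policy
    (fun t => ‖Q t - M.actionValue (ActorCritic.softmax (P t))‖) =O[Filter.atTop] ActorCritic.eta ∧
    -- the objective is differentiable in the logits, so that its gradient is a genuine one
    Differentiable ℝ (fun P' : X × A → ℝ => M.objective (ActorCritic.softmax P')) ∧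
    -- the actor converges to a stationary point if the clipping window contains the values
    ((∀ f : X × A → ℝ, ActorCritic.IsPolicy f → ∀ ξ, M.actionValue f ξ ∈ Set.Icc lo hi) →
      Filter.Tendsto (fun t => M.policyGradient (P t)) Filter.atTop (nhds 0)) := by
  have hK := ActorCritic.kernel_posDef heX heA hbias hact hconst hac hc hw
  refine ⟨?_, fun P' => ?_, fun hwin => ?_⟩
  · obtain ⟨C, -, hC⟩ := hODE.critic_tracks hM hK hα
    refine Asymptotics.IsBigO.of_bound C ?_
    filter_upwards [hC] with t ht
    rwa [norm_norm, Real.norm_of_nonneg (ActorCritic.eta_pos t).le]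
  · obtain ⟨L, -, hL⟩ := M.objective_hasFDerivAt P'
    exact hL.differentiableAt
  · have hκ0 : 0 < κ := by
      rcases hκ with rfl | rfl
      · exact one_pos
      · exact M.one_sub_γ_pos
    simp only [M.policyGradient_eq]
    exact hODE.gradient_tendsto_zero hM hK hα hκ0 hwin
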